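/- Let $E(1,1)$ be the connected three-dimensional Lie group of orientation and time-orientation preserving rigid motions of the Minkowski plane, i.e. $\mathbb R^3$ with the product $$(a,b,s)(a',b',s')=(a+a'\cosh s+b'\sinh s,\; b+a'\sinh s+b'\cosh s,\; s+s'),$$ and let $\mathfrak g$ be its Lie algebra, identified with the left-invariant vector fields. Call a basis $V_1,V_2,V_3$ of $\mathfrak g$ a Milnor basis if $$[V_2,V_3]=2V_1,\qquad [V_3,V_1]=-2V_2,\qquad [V_1,V_2]=0,$$ i.e. $[V_i,V_j]=\sum_k\epsilon_{ijk}\lambda_kV_k$ with $(\lambda_1,\lambda_2,\lambda_3)=(2,-2,0)$. Let $T$ be a left-invariant $(0,2)$ tensor field on $E(1,1)$. By a solution we mean a pair $(g,c)$ of a left-invariant Riemannian metric $g$ on $E(1,1)$ and a constant $c>0$ such that $\mathrm{Ric}(g)=cT$. A solution exists if and only if there are a Milnor basis $V_1,V_2,V_3$ and real numbers $T_1,T_2,T_3$ with $T(V_i,V_j)=\delta_{ij}T_i$ for all $i,j$ such that one of the following holds: (i) $T_1=T_2=0$ and $T_3<0$; (ii) $T_1+T_2>0$, $T_3<0$ and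 $T_1T_2<0$. Moreover, whenever $T=\mathrm{diag}(T_1,T_2,T_3)$ in a Milnor basis: in case (i) there are infinitely many solutions $(g,c)$, even when metrics that are scalar multiples of each other are identified, but the value of $c$ is the same for all of them; in case (ii) the solution is unique up to scaling of $g$, that is, there is a solution $(g,c)$, and every solution $(\bar g,\bar c)$ satisfies $\bar c=c$ and $\bar g=rg$ for some $r>0$. -/

import Mathlib

open scoped Manifold ContDiff Bundle

noncomputable section

/-! ## Ricci curvature in coordinates -/

namespace Coord

/-- The partial derivative `∂ₖ f` of a real function on `ℝⁿ`. -/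
def pderiv {n : ℕ} (k : Fin n) (f : (Fin n → ℝ) → ℝ) (x : Fin n → ℝ) : ℝ :=
  fderiv ℝ f x (Pi.single k 1)

/-- The Christoffel symbol
`Γᵏᵢⱼ = ½ ∑ₗ gᵏˡ (∂ᵢ gⱼₗ + ∂ⱼ gᵢₗ - ∂ₗ gᵢⱼ)`
of the Riemannian metric on `ℝⁿ` with component matrix `g`. -/
def christoffel {n : ℕ} (g : (Fin n → ℝ) → Matrix (Fin n) (Fin n) ℝ) (k i j : Fin n)
    (x : Fin n → ℝ) : ℝ :=
  (1 / 2) * ∑ l, (g x)⁻¹ k l *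
    (pderiv i (fun y => g y j l) x + pderiv j (fun y => g y i l) x
      - pderiv l (fun y => g y i j) x)

/-- The component
`Ricᵢⱼ = ∑ₖ (∂ₖ Γᵏᵢⱼ - ∂ⱼ Γᵏᵢₖ) + ∑ₖₗ (Γᵏₖₗ Γˡᵢⱼ - Γᵏⱼₗ Γˡᵢₖ)`
of the Ricci curvature of the Riemannian metric on `ℝⁿ` with component matrix `g`
(the sign for which round spheres have positive Ricci curvature). -/
def ricci {n : ℕ} (g : (Fin n → ℝ) → Matrix (Fin n) (Fin n) ℝ) (i j : Fin n)
    (x : Fin n → ℝ) : ℝ :=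
  (∑ k, (pderiv k (christoffel g k i j) x - pderiv j (christoffel g k i k) x))
    + ∑ k, ∑ l, (christoffel g k k l x * christoffel g l i j x
        - christoffel g k j l x * christoffel g l i k x)

end Coord

/-! ## The group `E(1,1)` -/

/-- The three-dimensional Lie group `E(1,1)` of rigid motions of the Minkowski plane
(orientation and time orientation preserving, so that the group is connected).
The triple `(a, b, s)` stands for the motion
`(x, y) ↦ (x cosh s + y sinh s + a, x sinh s + y cosh s + b)` of the plane with the
quadratic form `x² - y²`. -/
def E11 : Type := Fin 3 → ℝ

namespace E11

/-- The product is the composition of motions. -/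
instance : Mul E11 :=
  ⟨fun p q => ![p 0 + Real.cosh (p 2) * q 0 + Real.sinh (p 2) * q 1,
    p 1 + Real.sinh (p 2) * q 0 + Real.cosh (p 2) * q 1, p 2 + q 2]⟩

instance : One E11 := ⟨![0, 0, 0]⟩

instance : Inv E11 :=
  ⟨fun p => ![-(Real.cosh (p 2) * p 0) + Real.sinh (p 2) * p 1,
    Real.sinh (p 2) * p 0 - Real.cosh (p 2) * p 1, -p 2]⟩

/-- The action of a motion on the Minkowski plane. -/
def act (p : E11) (v : ℝ × ℝ) : ℝ × ℝ :=
  (v.1 * Real.cosh (p 2) + v.2 * Real.sinh (p 2) + p 0,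
    v.1 * Real.sinh (p 2) + v.2 * Real.cosh (p 2) + p 1)

theorem mul_zero_apply (p q : E11) :
    (p * q) 0 = p 0 + Real.cosh (p 2) * q 0 + Real.sinh (p 2) * q 1 := rfl

theorem mul_one_apply (p q : E11) :
    (p * q) 1 = p 1 + Real.sinh (p 2) * q 0 + Real.cosh (p 2) * q 1 := rfl

theorem mul_two_apply (p q : E11) : (p * q) 2 = p 2 + q 2 := rfl

theorem act_mul (p q : E11) (v : ℝ × ℝ) : act (p * q) v = act p (act q v) := by
  ext <;> simp only [act, mul_zero_apply, mul_one_apply, mul_two_apply, Real.cosh_add,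
    Real.sinh_add] <;> ring

theorem ext_apply {p q : E11} (h0 : p 0 = q 0) (h1 : p 1 = q 1) (h2 : p 2 = q 2) : p = q := by
  funext i
  fin_cases i
  · exact h0
  · exact h1
  · exact h2

instance : Group E11 where
  mul_assoc p q r := by
    apply ext_apply <;> simp only [mul_zero_apply, mul_one_apply, mul_two_apply, Real.cosh_add,
      Real.sinh_add] <;> ring
  one_mul p := by
    have h0 : (1 : E11) 0 = 0 := rfl
    have h1 : (1 : E11) 1 = 0 := rfl
    have h2 : (1 : E11) 2 = 0 := rfl
    apply ext_apply <;> simp [mul_zero_apply, mul_one_apply, mul_two_apply, h0, h1, h2]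
  mul_one p := by
    have h0 : (1 : E11) 0 = 0 := rfl
    have h1 : (1 : E11) 1 = 0 := rfl
    have h2 : (1 : E11) 2 = 0 := rfl
    apply ext_apply <;> simp [mul_zero_apply, mul_one_apply, mul_two_apply, h0, h1, h2]
  inv_mul_cancel p := by
    have h0 : (p⁻¹) 0 = -(Real.cosh (p 2) * p 0) + Real.sinh (p 2) * p 1 := rfl
    have h1 : (p⁻¹) 1 = Real.sinh (p 2) * p 0 - Real.cosh (p 2) * p 1 := rfl
    have h2 : (p⁻¹) 2 = -p 2 := rfl
    have k0 : (1 : E11) 0 = 0 := rfl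
    have k1 : (1 : E11) 1 = 0 := rfl
    have k2 : (1 : E11) 2 = 0 := rfl
    apply ext_apply <;> simp only [mul_zero_apply, mul_one_apply, mul_two_apply, h0, h1, h2,
      k0, k1, k2, Real.cosh_neg, Real.sinh_neg] <;> ring

instance : TopologicalSpace E11 := inferInstanceAs (TopologicalSpace (Fin 3 → ℝ))

/-- The smooth structure for which `(a, b, s)` are global coordinates. -/
instance : ChartedSpace (Fin 3 → ℝ) E11 :=
  inferInstanceAs (ChartedSpace (Fin 3 → ℝ) (Fin 3 → ℝ))

instance (n : ℕ∞ω) : IsManifold 𝓘(ℝ, Fin 3 → ℝ) n E11 :=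
  inferInstanceAs (IsManifold 𝓘(ℝ, Fin 3 → ℝ) n (Fin 3 → ℝ))

theorem contDiff_mul (n : ℕ∞ω) : ContDiff ℝ n
    (fun p : (Fin 3 → ℝ) × (Fin 3 → ℝ) =>
      (![p.1 0 + Real.cosh (p.1 2) * p.2 0 + Real.sinh (p.1 2) * p.2 1,
        p.1 1 + Real.sinh (p.1 2) * p.2 0 + Real.cosh (p.1 2) * p.2 1,
        p.1 2 + p.2 2] : Fin 3 → ℝ)) := by
  rw [contDiff_pi]
  intro i
  fin_cases i <;> simp <;> fun_prop

theorem contDiff_inv (n : ℕ∞ω) : ContDiff ℝ n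
    (fun p : Fin 3 → ℝ =>
      (![-(Real.cosh (p 2) * p 0) + Real.sinh (p 2) * p 1,
        Real.sinh (p 2) * p 0 - Real.cosh (p 2) * p 1, -p 2] : Fin 3 → ℝ)) := by
  rw [contDiff_pi]
  intro i
  fin_cases i <;> simp <;> fun_prop

instance (n : ℕ∞ω) : LieGroup 𝓘(ℝ, Fin 3 → ℝ) n E11 where
  contMDiff_mul := by
    have h := (contDiff_mul n).contMDiff
    rw [modelWithCornersSelf_prod, ← chartedSpaceSelf_prod] at h
    exact h
  contMDiff_inv := (contDiff_inv n).contMDiff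

/-- The Lie algebra of `E(1,1)`. -/
abbrev LieAlg : Type := GroupLieAlgebra 𝓘(ℝ, Fin 3 → ℝ) E11

/-- The tangent space of `E(1,1)` at `p`. -/
abbrev Tan (p : E11) : Type := TangentSpace 𝓘(ℝ, Fin 3 → ℝ) p

/-- A `(0,2)` tensor field on `E(1,1)`. -/
abbrev TensorField : Type := (p : E11) → Tan p →L[ℝ] Tan p →L[ℝ] ℝ

/-- A smooth Riemannian metric on `E(1,1)`. -/
abbrev Metric : Type :=
  Bundle.ContMDiffRiemannianMetric 𝓘(ℝ, Fin 3 → ℝ) ∞ (Fin 3 → ℝ) (fun p : E11 => Tan p)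

/-- The tensor field `T` is invariant under all left translations `q ↦ a * q`. -/
def LeftInvariant (T : TensorField) : Prop :=
  ∀ (a p : E11) (u v : Tan p),
    T (a * p) (mfderiv 𝓘(ℝ, Fin 3 → ℝ) 𝓘(ℝ, Fin 3 → ℝ) (fun q : E11 => a * q) p u)
      (mfderiv 𝓘(ℝ, Fin 3 → ℝ) 𝓘(ℝ, Fin 3 → ℝ) (fun q : E11 => a * q) p v) = T p u v

/-- The coordinate vector fields of the global coordinates. -/
def coordField (i : Fin 3) (p : E11) : Tan p := (Pi.single i 1 : Fin 3 → ℝ)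

/-- The component matrix of a metric in the global coordinates. -/
def components (g : Metric) (x : Fin 3 → ℝ) : Matrix (Fin 3) (Fin 3) ℝ :=
  Matrix.of fun i j => g.inner (x : E11) (coordField i x) (coordField j x)

/-- The Ricci curvature of a Riemannian metric on `E(1,1)`, as a function of a point and of
two tangent vectors at it (whose entries are their components in the coordinate frame). -/
def Ric (g : Metric) (p : E11) (u v : Tan p) : ℝ :=
  ∑ i : Fin 3, ∑ j : Fin 3,
    Coord.ricci (components g) i j p * (u : Fin 3 → ℝ) i * (v : Fin 3 → ℝ) j

/-- `(g, c)` is a solution of `Ric(g) = c T` with `g` a left-invariant Riemannian metric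
and `c > 0`. -/
def IsSolution (T : TensorField) (g : Metric) (c : ℝ) : Prop :=
  LeftInvariant g.inner ∧ 0 < c ∧ ∀ (p : E11) (u v : Tan p), Ric g p u v = c * T p u v

/-- The metric `h` is a positive scalar multiple of `g`. -/
def Homothetic (g h : Metric) : Prop :=
  ∃ r : ℝ, 0 < r ∧ ∀ (p : E11) (u v : Tan p), h.inner p u v = r * g.inner p u v

/-- The bracket relations `[Vᵢ, Vⱼ] = ∑ₖ εᵢⱼₖ λₖ Vₖ` with `(λ₁, λ₂, λ₃) = (2, -2, 0)`. -/
def IsMilnorBasis (V : Module.Basis (Fin 3) ℝ LieAlg) : Prop :=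
  ⁅V 1, V 2⁆ = (2 : ℝ) • V 0 ∧ ⁅V 2, V 0⁆ = (-2 : ℝ) • V 1 ∧ ⁅V 0, V 1⁆ = (0 : ℝ) • V 2

/-- The tensor field `T` has the matrix `diag(t₁, t₂, t₃)` with respect to the left-invariant
vector fields given by the basis `V` of the Lie algebra. -/
def IsDiagonal (T : TensorField) (V : Module.Basis (Fin 3) ℝ LieAlg) (t : Fin 3 → ℝ) : Prop :=
  ∀ (p : E11) (i j : Fin 3),
    T p (mulInvariantVectorField (V i) p) (mulInvariantVectorField (V j) p)
      = if i = j then t i else 0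

end E11

end

/-! In the null frame U = (1,1,0), W = (1,-1,0) the boosts are diagonal, with factors e^s and
e^(-s). A left-invariant metric amounts to its Gram matrix (α, β; β, δ) on the plane of U and W, the
vector S = e₂ + yU + zW orthogonal to that plane, and ρ = |S|². Inner automorphisms by translations
move y, z to 0, so Ric is also block diagonal with respect to S. With D = αδ - β² the computation in
`ricciOf_null` gives Ric(U,U) = 2β²α/(Dρ), Ric(U,W) = 2αδβ/(Dρ), Ric(W,W) = 2β²δ/(Dρ), Ric(S,S) =
-2αδ/D.

The bracket relations force a Milnor basis to be V₁ = aU + bW, V₂ = ε(aU - bW), V₃ = -2εS with ε =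
±1, for some S as above. Hence T = diag(T₁,T₂,T₃) means that T is block diagonal with T(U,U) =
(T₁+T₂)/4a², T(U,W) = (T₁-T₂)/4ab, T(W,W) = (T₁+T₂)/4b², T(S,S) = T₃/4 (`IsDiagonal.exists_isNull`,
`exists_milnorBasis`), and Ric = cT becomes four scalar equations.

If β = 0, Ric vanishes on the plane and Ric(S,S) = -2: this is case (i), where c is forced and ρ is
free. If β ≠ 0, T₁T₂ has the sign of -β²D < 0: this is case (ii). Quotients of the planar equations
give α : β : δ, the S-equation then gives c, and one planar equation gives ρ; y and z are determined
because T is nondegenerate on the plane (`IsSolution.unique`). -/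

noncomputable section

/-! ### Left translations, the Lie bracket and left-invariant tensors in coordinates -/

namespace E11

/-- The differential of the left translation by an element with last entry `s`, in the global
coordinates. -/
def boost (s : ℝ) (u : Fin 3 → ℝ) : Fin 3 → ℝ :=
  ![Real.cosh s * u 0 + Real.sinh s * u 1, Real.sinh s * u 0 + Real.cosh s * u 1, u 2]

theorem boost_boost (s t : ℝ) (u : Fin 3 → ℝ) : boost s (boost t u) = boost (s + t) u := by
  funext i
  fin_cases i <;> simp [boost, Real.cosh_add, Real.sinh_add] <;> ring

theorem boost_zero (u : Fin 3 → ℝ) : boost 0 u = u := by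
  funext i
  fin_cases i <;> simp [boost]

/-- The differential `boost s` as a continuous linear map. -/
def boostL (s : ℝ) : (Fin 3 → ℝ) →L[ℝ] (Fin 3 → ℝ) :=
  LinearMap.toContinuousLinearMap
    { toFun := boost s
      map_add' := fun u v => by
        funext i
        fin_cases i <;> simp [boost] <;> ring
      map_smul' := fun c u => by
        funext i
        fin_cases i <;> simp [boost] <;> ring }

/-- Left translation is affine in the global coordinates, so its differential is its linear part at
every point. -/
theorem mfderiv_leftMul (a p : E11) (u : Tan p) :
    (mfderiv 𝓘(ℝ, Fin 3 → ℝ) 𝓘(ℝ, Fin 3 → ℝ) (fun q : E11 => a * q) p u : Fin 3 → ℝ)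
      = boost (a 2) u := by
  let b : Fin 3 → ℝ := a
  have e : (fun q : E11 => a * q) = fun q : Fin 3 → ℝ => b + boostL (a 2) q := by
    funext q
    have hq : ∀ i, (a * q) i = a i + boost (a 2) q i := by
      intro i
      fin_cases i
      · exact (mul_zero_apply a q).trans (add_assoc _ _ _)
      · exact (mul_one_apply a q).trans (add_assoc _ _ _)
      · exact mul_two_apply a q
    exact funext hq
  rw [e]
  have h : mfderiv 𝓘(ℝ, Fin 3 → ℝ) 𝓘(ℝ, Fin 3 → ℝ)
      (fun q : Fin 3 → ℝ => b + boostL (a 2) q) (p : Fin 3 → ℝ) = boostL (a 2) :=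
    mfderiv_eq_fderiv.trans ((boostL (a 2)).hasFDerivAt.const_add _).fderiv
  exact congrArg (fun L : (Fin 3 → ℝ) →L[ℝ] (Fin 3 → ℝ) => L u) h

theorem mulInvariantVectorField_eq (v : LieAlg) (p : E11) :
    mulInvariantVectorField v p = boost (p 2) v :=
  mfderiv_leftMul p 1 v

/-- The fields p ↦ `boost (p 2) v` depend on the third coordinate only, and the derivative of the
boost at 0 swaps the first two entries. -/
theorem bracket_eq (v w : LieAlg) :
    (⁅v, w⁆ : LieAlg) =
      (![(v : Fin 3 → ℝ) 2 * (w : Fin 3 → ℝ) 1 - (w : Fin 3 → ℝ) 2 * (v : Fin 3 → ℝ) 1,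
        (v : Fin 3 → ℝ) 2 * (w : Fin 3 → ℝ) 0 - (w : Fin 3 → ℝ) 2 * (v : Fin 3 → ℝ) 0,
        0] : Fin 3 → ℝ) := by
  have key : ∀ v : Fin 3 → ℝ, HasFDerivAt (fun p : Fin 3 → ℝ => boost (p 2) v)
      ((ContinuousLinearMap.proj (R := ℝ) (φ := fun _ : Fin 3 => ℝ) 2).smulRight
        (![v 1, v 0, 0] : Fin 3 → ℝ)) 0 := by
    intro v
    rw [hasFDerivAt_pi']
    have h2 : HasFDerivAt (fun p : Fin 3 → ℝ => p 2)
      (ContinuousLinearMap.proj (R := ℝ) (φ := fun _ : Fin 3 => ℝ) 2) 0 :=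
      hasFDerivAt_apply 2 0
    have hc := h2.cosh
    have hs := h2.sinh
    intro i
    fin_cases i
    · refine ((hc.mul_const (v 0)).add (hs.mul_const (v 1))).congr_fderiv ?_
      ext w; simp [mul_comm]
    · refine ((hs.mul_const (v 0)).add (hc.mul_const (v 1))).congr_fderiv ?_
      ext w; simp [mul_comm]
    · refine (hasFDerivAt_const (v 2) _).congr_fderiv ?_
      ext w; simp
  have h1 : (⁅v, w⁆ : LieAlg) = VectorField.mlieBracketWithin 𝓘(ℝ, Fin 3 → ℝ) (M := Fin 3 → ℝ)
      (fun p => boost (p 2) v) (fun p => boost (p 2) w) Set.univ (0 : Fin 3 → ℝ) := by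
    have e : ∀ v : LieAlg, (mulInvariantVectorField v : (p : E11) → Tan p) =
        fun p => boost (p 2) v := fun v => funext (mulInvariantVectorField_eq v)
    have o : (1 : E11) = (0 : Fin 3 → ℝ) := by
      funext i; fin_cases i <;> rfl
    rw [GroupLieAlgebra.bracket_def, e, e, o]
    rfl
  rw [h1]
  have h3 := congrFun (VectorField.mlieBracketWithin_eq_lieBracketWithin (𝕜 := ℝ)
    (V := fun p : Fin 3 → ℝ => boost (p 2) v) (W := fun p : Fin 3 → ℝ => boost (p 2) w)
    (s := Set.univ)) 0
  refine h3.trans ?_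
  rw [VectorField.lieBracketWithin_univ, VectorField.lieBracket, (key v).fderiv, (key w).fderiv]
  funext i
  fin_cases i <;> simp [boost]

theorem LeftInvariant.apply_eq {T : TensorField} (hT : LeftInvariant T) (p : E11)
    (u v : Fin 3 → ℝ) :
    T p u v = T 1 (boost (-p 2) u) (boost (-p 2) v) := by
  have h := hT p 1 (boost (-p 2) u) (boost (-p 2) v)
  have e : ∀ u : Fin 3 → ℝ, mfderiv 𝓘(ℝ, Fin 3 → ℝ) 𝓘(ℝ, Fin 3 → ℝ) (fun q : E11 => p * q) 1
      (boost (-p 2) u) = u := by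
    intro u
    refine (mfderiv_leftMul p 1 _).trans ?_
    rw [boost_boost, add_neg_cancel, boost_zero]
  rw [← h, e, e, mul_one]

theorem leftInvariant_of_apply_eq {T : TensorField} (B : (Fin 3 → ℝ) → (Fin 3 → ℝ) → ℝ)
    (h : ∀ (p : E11) (u v : Fin 3 → ℝ), T p u v = B (boost (-p 2) u) (boost (-p 2) v)) :
    LeftInvariant T := by
  intro a p u v
  rw [h p u v]
  refine (h _ _ _).trans ?_
  have e : ∀ u : Tan p, boost (-(a * p) 2) (mfderiv 𝓘(ℝ, Fin 3 → ℝ) 𝓘(ℝ, Fin 3 → ℝ)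
      (fun q : E11 => a * q) p u) = boost (-p 2) u := by
    intro u
    rw [mul_two_apply]
    refine (congrArg _ (mfderiv_leftMul a p u)).trans ?_
    refine (boost_boost _ _ _).trans ?_
    congr 1
    ring
  rw [e, e]

end E11

/-! ### Analytic requirements on a smooth Riemannian metric -/

/-- A positive definite bilinear form on a finite-dimensional space has bounded unit ball. -/
theorem isVonNBounded_of_posDef {F : Type*} [NormedAddCommGroup F] [NormedSpace ℝ F]
    [FiniteDimensional ℝ F] (B : F →L[ℝ] F →L[ℝ] ℝ) (hB : ∀ v, v ≠ 0 → 0 < B v v) :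
    Bornology.IsVonNBounded ℝ {v : F | B v v < 1} := by
  rw [NormedSpace.isVonNBounded_iff, isBounded_iff_forall_norm_le]
  have hc : Continuous fun v => B v v := B.continuous.clm_apply continuous_id
  rcases subsingleton_or_nontrivial F with hF | hF
  · exact ⟨0, fun x _ => by simp [Subsingleton.elim x 0]⟩
  obtain ⟨w, hw, hmin⟩ := (isCompact_sphere (0 : F) 1).exists_isMinOn
    (NormedSpace.sphere_nonempty.2 zero_le_one) hc.continuousOn
  have hm : 0 < B w w := hB w (fun h => by simp [h] at hw)
  refine ⟨√(1 / B w w), fun x hx => ?_⟩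
  rcases eq_or_ne x 0 with rfl | hx0
  · simp
  have hn : 0 < ‖x‖ := norm_pos_iff.2 hx0
  -- The minimum of the form over the unit sphere bounds it below by a multiple of the squared norm.
  have h1 : B w w ≤ B (‖x‖⁻¹ • x) (‖x‖⁻¹ • x) :=
    hmin (by simp [norm_smul, hn.ne'])
  simp only [map_smul, smul_apply, smul_eq_mul] at h1
  apply Real.le_sqrt_of_sq_le
  rw [le_div_iff₀ hm]
  have h2 : ‖x‖⁻¹ * (‖x‖⁻¹ * B x x) = B x x / ‖x‖ ^ 2 := by field_simp
  rw [h2, le_div_iff₀ (by positivity)] at h1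
  have hx' : B x x < 1 := hx
  linarith

/-- A smooth field of bilinear forms on a normed space is a smooth section of the bundle of
bilinear forms on the tangent spaces. -/
theorem contMDiff_section_bilin {F : Type*} [NormedAddCommGroup F] [NormedSpace ℝ F] {n : ℕ∞ω}
    {B : F → F →L[ℝ] F →L[ℝ] ℝ} (hB : ContDiff ℝ n B) :
    ContMDiff 𝓘(ℝ, F) (𝓘(ℝ, F).prod 𝓘(ℝ, F →L[ℝ] F →L[ℝ] ℝ)) n
      (fun b : F => Bundle.TotalSpace.mk' (F →L[ℝ] F →L[ℝ] ℝ)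
        (E := fun x : F => TangentSpace 𝓘(ℝ, F) x →L[ℝ] TangentSpace 𝓘(ℝ, F) x →L[ℝ] ℝ)
        b (B b)) := by
  -- Over a normed space the trivializations of the cotangent bundle are the identity on fibres.
  have key : ∀ (x p : F) (φ : TangentSpace 𝓘(ℝ, F) p →L[ℝ] ℝ),
      (trivializationAt (F →L[ℝ] ℝ) (fun x : F => TangentSpace 𝓘(ℝ, F) x →L[ℝ] ℝ)
        x).linearMapAt ℝ p φ = φ := by
    intro x p φ
    rw [Bundle.Trivialization.linearMapAt_apply]
    rw [if_pos (by rw [hom_trivializationAt_baseSet]; simp [chartAt_self_eq])]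
    rw [hom_trivializationAt_apply]
    apply ContinuousLinearMap.ext
    intro w
    simp [ContinuousLinearMap.inCoordinates]
    rfl
  intro x
  refine (Bundle.contMDiffAt_section x).2 ?_
  refine ContMDiffAt.congr_of_eventuallyEq (hB.contMDiff.contMDiffAt (x := x)) ?_
  refine Filter.Eventually.of_forall fun p => ?_
  apply ContinuousLinearMap.ext
  intro v
  apply ContinuousLinearMap.ext
  intro w
  simp [hom_trivializationAt_apply, ContinuousLinearMap.inCoordinates]
  exact congrArg (fun φ : F →L[ℝ] ℝ => φ w) (key x p (B p v))

theorem ContDiff.smul_const_vector {E F : Type*} [NormedAddCommGroup E] [NormedSpace ℝ E]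
    [NormedAddCommGroup F] [NormedSpace ℝ F] {n : ℕ∞ω} {c : E → ℝ} (hc : ContDiff ℝ n c) (b : F) :
    ContDiff ℝ n fun p => c p • b :=
  hc.smul contDiff_const

theorem contDiff_smul_smulRight {E F : Type*} [NormedAddCommGroup E] [NormedSpace ℝ E]
    [NormedAddCommGroup F] [NormedSpace ℝ F] {n : ℕ∞ω} {c : E → ℝ} (hc : ContDiff ℝ n c)
    (φ ψ : F →L[ℝ] ℝ) : ContDiff ℝ n fun p => c p • φ.smulRight ψ :=
  hc.smul_const_vector _

/-! ### Null forms and the left-invariant metrics they define -/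

namespace E11

/-- The symmetric bilinear form
`α ξ² + 2 β ξ η + δ η² + ρ σ²` in the coframe `ξ = (e⁰ + e¹) / 2 - y e²`,
`η = (e⁰ - e¹) / 2 - z e²`, `σ = e²`. -/
def nullForm (α β δ ρ y z : ℝ) (u v : Fin 3 → ℝ) : ℝ :=
  α * ((u 0 + u 1) / 2 - y * u 2) * ((v 0 + v 1) / 2 - y * v 2)
    + β * (((u 0 + u 1) / 2 - y * u 2) * ((v 0 - v 1) / 2 - z * v 2)
      + ((u 0 - u 1) / 2 - z * u 2) * ((v 0 + v 1) / 2 - y * v 2))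
    + δ * ((u 0 - u 1) / 2 - z * u 2) * ((v 0 - v 1) / 2 - z * v 2) + ρ * u 2 * v 2

theorem boost_neg_zero_add_one (s : ℝ) (u : Fin 3 → ℝ) :
    boost (-s) u 0 + boost (-s) u 1 = (Real.exp s)⁻¹ * (u 0 + u 1) := by
  simp only [boost, Real.cosh_eq, Real.sinh_eq, neg_neg, Real.exp_neg]
  simp
  ring

theorem boost_neg_zero_sub_one (s : ℝ) (u : Fin 3 → ℝ) :
    boost (-s) u 0 - boost (-s) u 1 = Real.exp s * (u 0 - u 1) := by
  simp only [boost, Real.cosh_eq, Real.sinh_eq, neg_neg, Real.exp_neg]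
  simp
  ring

theorem boost_two (s : ℝ) (u : Fin 3 → ℝ) : boost s u 2 = u 2 := rfl

/-- Boosts only rescale the null covectors, so the components of a left-invariant tensor stay in one
six-parameter family as the point moves. -/
theorem nullForm_boost (α β δ ρ y z s : ℝ) (u v : Fin 3 → ℝ) :
    nullForm α β δ ρ y z (boost (-s) u) (boost (-s) v) =
      nullForm (α * (Real.exp s)⁻¹ ^ 2) β (δ * Real.exp s ^ 2) ρ (y * Real.exp s)
        (z * (Real.exp s)⁻¹) u v := by
  have h : Real.exp s ≠ 0 := (Real.exp_pos s).ne'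
  simp only [nullForm, boost_neg_zero_add_one, boost_neg_zero_sub_one, boost_two]
  field_simp

theorem nullForm_self_pos {α β δ ρ : ℝ} (hα : 0 < α) (hρ : 0 < ρ) (hD : 0 < α * δ - β ^ 2)
    (y z : ℝ) {v : Fin 3 → ℝ} (hv : v ≠ 0) : 0 < nullForm α β δ ρ y z v v := by
  set ξ := (v 0 + v 1) / 2 - y * v 2 with hξ
  set η := (v 0 - v 1) / 2 - z * v 2 with hη
  have e : nullForm α β δ ρ y z v v
      = ((α * ξ + β * η) ^ 2 + (α * δ - β ^ 2) * η ^ 2) / α + ρ * v 2 ^ 2 := by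
    simp only [nullForm, ← hξ, ← hη]
    field_simp
    ring
  have h0 : 0 ≤ ((α * ξ + β * η) ^ 2 + (α * δ - β ^ 2) * η ^ 2) / α := by positivity
  rw [e]
  by_contra hle
  have hσ : ρ * v 2 ^ 2 ≥ 0 := by positivity
  have h2 : ρ * v 2 ^ 2 = 0 := by linarith
  have h3 : ((α * ξ + β * η) ^ 2 + (α * δ - β ^ 2) * η ^ 2) / α = 0 := by linarith
  have k2 : v 2 = 0 := by simpa [hρ.ne'] using h2
  have h4 : (α * ξ + β * η) ^ 2 + (α * δ - β ^ 2) * η ^ 2 = 0 := by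
    simpa [hα.ne'] using h3
  have h5 : (α * δ - β ^ 2) * η ^ 2 = 0 := by nlinarith [sq_nonneg (α * ξ + β * η), sq_nonneg η]
  have kη : η = 0 := by simpa [hD.ne'] using h5
  have kξ : ξ = 0 := by simpa [kη, hα.ne'] using h4
  rw [k2] at hξ hη
  apply hv
  funext i
  fin_cases i
  · change v 0 = 0; linarith
  · change v 1 = 0; linarith
  · exact k2

/-- Extension of a function on pairs of basis vectors to a continuous bilinear form. -/
def bilinOf (c : Fin 3 → Fin 3 → ℝ) : (Fin 3 → ℝ) →L[ℝ] (Fin 3 → ℝ) →L[ℝ] ℝ :=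
  ∑ i, ∑ j, c i j • (ContinuousLinearMap.proj (R := ℝ) (φ := fun _ : Fin 3 => ℝ) i).smulRight
    (ContinuousLinearMap.proj (R := ℝ) (φ := fun _ : Fin 3 => ℝ) j)

theorem bilinOf_apply (c : Fin 3 → Fin 3 → ℝ) (u v : Fin 3 → ℝ) :
    bilinOf c u v = ∑ i, ∑ j, c i j * (u i * v j) := by
  simp [bilinOf]

set_option synthInstance.maxHeartbeats 200000 in
theorem contDiff_bilinOf {E : Type*} [NormedAddCommGroup E] [NormedSpace ℝ E] {n : ℕ∞ω}
    {c : E → Fin 3 → Fin 3 → ℝ} (hc : ∀ i j, ContDiff ℝ n fun p => c p i j) :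
    ContDiff ℝ n fun p => bilinOf (c p) := by
  unfold bilinOf
  refine ContDiff.sum fun i _ => ContDiff.sum fun j _ => ?_
  exact contDiff_smul_smulRight (hc i j) _ _

theorem nullForm_eq_sum (α β δ ρ y z : ℝ) (u v : Fin 3 → ℝ) :
    nullForm α β δ ρ y z u v = ∑ i, ∑ j,
      nullForm α β δ ρ y z (Pi.single i 1) (Pi.single j 1) * (u i * v j) := by
  simp [Fin.sum_univ_three, nullForm, Pi.single_apply]
  ring

/-- The components at a point of the left-invariant form extending a null form. -/
def nullCoeff (α β δ ρ y z s : ℝ) (i j : Fin 3) : ℝ :=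
  nullForm (α * (Real.exp s)⁻¹ ^ 2) β (δ * Real.exp s ^ 2) ρ (y * Real.exp s)
    (z * (Real.exp s)⁻¹) (Pi.single i 1) (Pi.single j 1)

theorem bilinOf_nullCoeff (α β δ ρ y z s : ℝ) (u v : Fin 3 → ℝ) :
    bilinOf (nullCoeff α β δ ρ y z s) u v =
      nullForm α β δ ρ y z (boost (-s) u) (boost (-s) v) := by
  rw [bilinOf_apply, nullForm_boost, nullForm_eq_sum]
  rfl

theorem nullForm_comm (α β δ ρ y z : ℝ) (u v : Fin 3 → ℝ) :
    nullForm α β δ ρ y z u v = nullForm α β δ ρ y z v u := by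
  simp only [nullForm]; ring

theorem boost_ne_zero {s : ℝ} {v : Fin 3 → ℝ} (hv : v ≠ 0) : boost s v ≠ 0 := by
  intro h
  apply hv
  have h2 := boost_boost (-s) s v
  rw [h, neg_add_cancel, boost_zero] at h2
  rw [← h2]
  funext i
  fin_cases i <;> simp [boost]

/-- The left-invariant metric which is a given null form at the identity. -/
def nullMetric (α β δ ρ y z : ℝ) (hα : 0 < α) (hρ : 0 < ρ) (hD : 0 < α * δ - β ^ 2) :
    Metric where
  inner p := bilinOf (nullCoeff α β δ ρ y z (p 2))
  symm p v w := by
    refine (bilinOf_nullCoeff _ _ _ _ _ _ _ _ _).trans ?_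
    rw [nullForm_comm]
    exact (bilinOf_nullCoeff _ _ _ _ _ _ _ _ _).symm
  pos p v hv := by
    refine lt_of_lt_of_eq ?_ (bilinOf_nullCoeff _ _ _ _ _ _ _ _ _).symm
    exact nullForm_self_pos hα hρ hD y z (boost_ne_zero hv)
  isVonNBounded p := by
    refine isVonNBounded_of_posDef (F := Fin 3 → ℝ) (bilinOf (nullCoeff α β δ ρ y z (p 2))) ?_
    intro v hv
    rw [bilinOf_nullCoeff]
    exact nullForm_self_pos hα hρ hD y z (boost_ne_zero hv)
  contMDiff := by
    have h : ContDiff ℝ ∞ (fun p : Fin 3 → ℝ => bilinOf (nullCoeff α β δ ρ y z (p 2))) := by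
      refine contDiff_bilinOf fun i j => ?_
      unfold nullCoeff nullForm
      have h2 : ContDiff ℝ ∞ (fun p : Fin 3 → ℝ => Real.exp (p 2)) := by fun_prop
      have h3 : ContDiff ℝ ∞ (fun p : Fin 3 → ℝ => (Real.exp (p 2))⁻¹) :=
        h2.inv fun p => (Real.exp_pos _).ne'
      fun_prop
    exact contMDiff_section_bilin h

theorem nullMetric_inner {α β δ ρ y z : ℝ} (hα : 0 < α) (hρ : 0 < ρ) (hD : 0 < α * δ - β ^ 2)
    (p : E11) (u v : Fin 3 → ℝ) :
    (nullMetric α β δ ρ y z hα hρ hD).inner p u v =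
      nullForm α β δ ρ y z (boost (-p 2) u) (boost (-p 2) v) :=
  bilinOf_nullCoeff _ _ _ _ _ _ _ _ _

end E11

/-! ### Ricci curvature of a metric depending on one coordinate -/

namespace Coord

theorem pderiv_comp_apply {n : ℕ} (m k : Fin n) {f : ℝ → ℝ} {f' : ℝ} {x : Fin n → ℝ}
    (hf : HasDerivAt f f' (x m)) :
    pderiv k (fun y => f (y m)) x = (Pi.single k 1 : Fin n → ℝ) m * f' := by
  have h := hf.comp_hasFDerivAt x (hasFDerivAt_apply (𝕜 := ℝ) m x)
  have h2 : fderiv ℝ (fun y : Fin n → ℝ => f (y m)) x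
    = f' • ContinuousLinearMap.proj (R := ℝ) (φ := fun _ : Fin n => ℝ) m := h.fderiv
  rw [pderiv, h2]
  simp [mul_comm]

/-- The Christoffel symbols of a metric with component matrix `G` and inverse `H` whose only
non-zero partial derivatives are the derivatives `G'` in the direction `m`. -/
def christoffelOf {n : ℕ} (m : Fin n) (H G' : Matrix (Fin n) (Fin n) ℝ) (k i j : Fin n) : ℝ :=
  (1 / 2) * ∑ l, H k l * ((Pi.single i 1 : Fin n → ℝ) m * G' j l
    + (Pi.single j 1 : Fin n → ℝ) m * G' i l - (Pi.single l 1 : Fin n → ℝ) m * G' i j)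

/-- The Ricci curvature of a metric which depends only on the coordinate `m`, in terms of the
inverse `H` of its component matrix, the derivatives `G'`, `G''` of the component matrix and the
derivative `H'` of the inverse. -/
def ricciOf {n : ℕ} (m : Fin n) (H H' G' G'' : Matrix (Fin n) (Fin n) ℝ) (i j : Fin n) : ℝ :=
  (∑ k, ((Pi.single k 1 : Fin n → ℝ) m *
        (christoffelOf m H' G' k i j + christoffelOf m H G'' k i j)
      - (Pi.single j 1 : Fin n → ℝ) m *
        (christoffelOf m H' G' k i k + christoffelOf m H G'' k i k)))
    + ∑ k, ∑ l, (christoffelOf m H G' k k l * christoffelOf m H G' l i j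
        - christoffelOf m H G' k j l * christoffelOf m H G' l i k)

/-- Only ∂ₘ survives, so the product rule turns Ricci into algebra. The inverse matrix and its
derivative enter as data, which avoids differentiating a matrix inverse. -/
theorem ricci_eq_ricciOf {n : ℕ} (m : Fin n) {g : (Fin n → ℝ) → Matrix (Fin n) (Fin n) ℝ}
    {G H G' H' G'' : ℝ → Matrix (Fin n) (Fin n) ℝ} (hg : ∀ x, g x = G (x m))
    (hH : ∀ s, (G s)⁻¹ = H s) (hG' : ∀ s i j, HasDerivAt (fun s => G s i j) (G' s i j) s)
    (hG'' : ∀ s i j, HasDerivAt (fun s => G' s i j) (G'' s i j) s)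
    (hH' : ∀ s i j, HasDerivAt (fun s => H s i j) (H' s i j) s) (i j : Fin n) (x : Fin n → ℝ) :
    ricci g i j x = ricciOf m (H (x m)) (H' (x m)) (G' (x m)) (G'' (x m)) i j := by
  have hc : ∀ k i j, christoffel g k i j
      = fun x => christoffelOf m (H (x m)) (G' (x m)) k i j := by
    intro k i j
    funext x
    have hp : ∀ k i j, pderiv k (fun y => g y i j) x
        = (Pi.single k 1 : Fin n → ℝ) m * G' (x m) i j := by
      intro k i j
      simp only [hg]
      exact pderiv_comp_apply m k (hG' (x m) i j)
    simp only [christoffel, christoffelOf, hp]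
    simp only [hg, hH]
  have hd : ∀ k i j s, HasDerivAt (fun s => christoffelOf m (H s) (G' s) k i j)
      (christoffelOf m (H' s) (G' s) k i j + christoffelOf m (H s) (G'' s) k i j) s := by
    intro k i j s
    simp only [christoffelOf]
    rw [← mul_add, ← Finset.sum_add_distrib]
    refine HasDerivAt.const_mul _ (HasDerivAt.fun_sum fun l _ => ?_)
    exact (hH' s k l).fun_mul ((((hG'' s j l).const_mul _).fun_add
      ((hG'' s i l).const_mul _)).fun_sub ((hG'' s i j).const_mul _))
  have hp : ∀ q k i j, pderiv q (christoffel g k i j) x = (Pi.single q 1 : Fin n → ℝ) m *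
      (christoffelOf m (H' (x m)) (G' (x m)) k i j
        + christoffelOf m (H (x m)) (G'' (x m)) k i j) := by
    intro q k i j
    rw [hc]
    exact pderiv_comp_apply m q (hd k i j (x m))
  rw [ricci, ricciOf]
  simp only [hp]
  simp only [hc]

end Coord

/-! ### Ricci curvature of a left-invariant metric in the null frame -/

namespace E11

/-- The component matrix of a null form. -/
def nullMatrix (α β δ ρ y z : ℝ) : Matrix (Fin 3) (Fin 3) ℝ :=
  !![(α + 2 * β + δ) / 4, (α - δ) / 4, -((α * y + β * y + β * z + δ * z) / 2);
    (α - δ) / 4, (α - 2 * β + δ) / 4, -((α * y - β * y + β * z - δ * z) / 2);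
    -((α * y + β * y + β * z + δ * z) / 2), -((α * y - β * y + β * z - δ * z) / 2),
    α * y ^ 2 + 2 * β * y * z + δ * z ^ 2 + ρ]

theorem nullForm_single (α β δ ρ y z : ℝ) (i j : Fin 3) :
    nullForm α β δ ρ y z (Pi.single i 1) (Pi.single j 1) = nullMatrix α β δ ρ y z i j := by
  fin_cases i <;> fin_cases j <;> simp [nullForm, nullMatrix] <;> ring

/-- The inverse of the component matrix of a null form. -/
def nullInv (α β δ ρ y z D : ℝ) : Matrix (Fin 3) (Fin 3) ℝ :=
  !![(α - 2 * β + δ) / D + (y + z) ^ 2 / ρ, (δ - α) / D + (y + z) * (y - z) / ρ, (y + z) / ρ;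
    (δ - α) / D + (y + z) * (y - z) / ρ, (α + 2 * β + δ) / D + (y - z) ^ 2 / ρ, (y - z) / ρ;
    (y + z) / ρ, (y - z) / ρ, 1 / ρ]

theorem nullMatrix_inv {α β δ ρ D : ℝ} (hρ : ρ ≠ 0) (hD : D ≠ 0) (h : α * δ - β ^ 2 = D)
    (y z : ℝ) : (nullMatrix α β δ ρ y z)⁻¹ = nullInv α β δ ρ y z D := by
  subst h
  apply Matrix.inv_eq_right_inv
  ext i j
  fin_cases i <;> fin_cases j <;>
    simp [nullMatrix, nullInv, Matrix.mul_apply, Fin.sum_univ_three] <;> field_simp <;> ring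

/-- The combination of the null vectors `e₀ + e₁`, `e₀ - e₁` and of `e₂ + y (e₀ + e₁) + z (e₀ - e₁)`
with the given coefficients. -/
def nullVec (y z u w σ : ℝ) : Fin 3 → ℝ := ![u + w + (y + z) * σ, u - w + (y - z) * σ, σ]

/-- The derivative of the component matrix of a null form along the boosts. -/
def nullMatrixDeriv (α β δ y z : ℝ) : Matrix (Fin 3) (Fin 3) ℝ :=
  !![(δ - α) / 2, -((α + δ) / 2), (α * y - β * y + β * z - δ * z) / 2;
    -((α + δ) / 2), (δ - α) / 2, (α * y + β * y + β * z + δ * z) / 2;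
    (α * y - β * y + β * z - δ * z) / 2, (α * y + β * y + β * z + δ * z) / 2, 0]

/-- The second derivative of the component matrix of a null form along the boosts. -/
def nullMatrixDeriv₂ (α β δ y z : ℝ) : Matrix (Fin 3) (Fin 3) ℝ :=
  !![α + δ, α - δ, -((α * y + β * y + β * z + δ * z) / 2);
    α - δ, α + δ, -((α * y - β * y + β * z - δ * z) / 2);
    -((α * y + β * y + β * z + δ * z) / 2), -((α * y - β * y + β * z - δ * z) / 2), 0]

/-- The derivative of the inverse of the component matrix of a null form along the boosts. -/
def nullInvDeriv (α δ ρ y z D : ℝ) : Matrix (Fin 3) (Fin 3) ℝ :=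
  !![2 * (δ - α) / D + 2 * (y + z) * (y - z) / ρ,
      2 * (α + δ) / D + ((y + z) ^ 2 + (y - z) ^ 2) / ρ, (y - z) / ρ;
    2 * (α + δ) / D + ((y + z) ^ 2 + (y - z) ^ 2) / ρ,
      2 * (δ - α) / D + 2 * (y + z) * (y - z) / ρ, (y + z) / ρ;
    (y - z) / ρ, (y + z) / ρ, 0]

/-- The Christoffel symbols of a left-invariant metric on `E(1,1)`. -/
def nullChristoffel (α β δ ρ y z D : ℝ) : Matrix (Fin 3) (Fin 3) (Fin 3 → ℝ) :=
  let a := nullVec y z 0 0 ((α - δ) / (4 * ρ))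
  let b := nullVec y z 0 0 ((α + δ) / (4 * ρ))
  let c := nullVec y z (-(δ * (α + β)) / (2 * D)) (α * (β + δ) / (2 * D))
    ((δ * z - α * y) / (2 * ρ))
  let d := nullVec y z (-(δ * (α - β)) / (2 * D)) (α * (β - δ) / (2 * D))
    (-(δ * z + α * y) / (2 * ρ))
  let e := nullVec y z ((α * δ * y + 2 * β * δ * z + β ^ 2 * y) / D)
    (-(α * δ * z + 2 * α * β * y + β ^ 2 * z) / D) ((α * y ^ 2 - δ * z ^ 2) / ρ)
  !![a, b, c; b, a, d; c, d, e]

/-- The derivatives along the boosts of the Christoffel symbols of a left-invariant metric on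
`E(1,1)`. -/
def nullChristoffelDeriv (α β δ ρ y z D : ℝ) : Matrix (Fin 3) (Fin 3) (Fin 3 → ℝ) :=
  let v (u w σ σ' : ℝ) : Fin 3 → ℝ :=
    ![u + w + (y - z) * σ + (y + z) * σ', u - w + (y + z) * σ + (y - z) * σ', σ']
  let a := v 0 0 ((α - δ) / (4 * ρ)) (-(α + δ) / (2 * ρ))
  let b := v 0 0 ((α + δ) / (4 * ρ)) ((δ - α) / (2 * ρ))
  let c := v (-(δ * β) / D) (-(α * β) / D) ((δ * z - α * y) / (2 * ρ))
    ((δ * z + α * y) / (2 * ρ))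
  let d := v (δ * β / D) (-(α * β) / D) (-(δ * z + α * y) / (2 * ρ))
    ((α * y - δ * z) / (2 * ρ))
  let e := v ((α * δ * y + 2 * β * δ * z + β ^ 2 * y) / D)
    ((α * δ * z + 2 * α * β * y + β ^ 2 * z) / D) ((α * y ^ 2 - δ * z ^ 2) / ρ) 0
  !![a, b, c; b, a, d; c, d, e]

theorem christoffelOf_null (α β δ y z : ℝ) {ρ D : ℝ} (hρ : ρ ≠ 0) (hD : D ≠ 0) (k i j : Fin 3) :
    Coord.christoffelOf 2 (nullInv α β δ ρ y z D) (nullMatrixDeriv α β δ y z) k i j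
      = nullChristoffel α β δ ρ y z D i j k := by
  fin_cases i <;> fin_cases j <;> fin_cases k <;>
    simp [Coord.christoffelOf, nullChristoffel, nullVec, nullInv, nullMatrixDeriv,
      Fin.sum_univ_three] <;> field_simp <;> ring

theorem christoffelOf_null_deriv (α β δ y z : ℝ) {ρ D : ℝ} (hρ : ρ ≠ 0) (hD : D ≠ 0)
    (k i j : Fin 3) :
    Coord.christoffelOf 2 (nullInvDeriv α δ ρ y z D) (nullMatrixDeriv α β δ y z) k i j
      + Coord.christoffelOf 2 (nullInv α β δ ρ y z D) (nullMatrixDeriv₂ α β δ y z) k i j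
      = nullChristoffelDeriv α β δ ρ y z D i j k := by
  fin_cases i <;> fin_cases j <;> fin_cases k <;>
    simp [Coord.christoffelOf, nullChristoffelDeriv, nullInv, nullMatrixDeriv,
      nullInvDeriv, nullMatrixDeriv₂, Fin.sum_univ_three] <;> field_simp <;> ring

/-- The central formula. The same y and z occur on both sides: the metric and its Ricci tensor share
the complement S of the plane. -/
theorem ricciOf_null {α β δ ρ D : ℝ} (hρ : ρ ≠ 0) (hD : D ≠ 0) (h : α * δ - β ^ 2 = D)
    (y z : ℝ) (i j : Fin 3) :
    Coord.ricciOf 2 (nullInv α β δ ρ y z D) (nullInvDeriv α δ ρ y z D)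
      (nullMatrixDeriv α β δ y z) (nullMatrixDeriv₂ α β δ y z) i j
      = nullMatrix (2 * β ^ 2 * α / (D * ρ)) (2 * α * δ * β / (D * ρ)) (2 * β ^ 2 * δ / (D * ρ))
        (-2 * α * δ / D) y z i j := by
  simp only [Coord.ricciOf, christoffelOf_null _ _ _ _ _ hρ hD,
    christoffelOf_null_deriv _ _ _ _ _ hρ hD]
  fin_cases i <;> fin_cases j <;>
  · simp [Fin.sum_univ_three, nullChristoffel, nullChristoffelDeriv, nullVec, nullMatrix]
    field_simp
    subst h
    ring

section Derivatives

variable {A Δ Y Z : ℝ → ℝ} (β ρ D : ℝ) {s : ℝ}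

theorem hasDerivAt_nullMatrix (hA : HasDerivAt A (-2 * A s) s)
    (hΔ : HasDerivAt Δ (2 * Δ s) s) (hY : HasDerivAt Y (Y s) s) (hZ : HasDerivAt Z (-Z s) s)
    (i j : Fin 3) :
    HasDerivAt (fun s => nullMatrix (A s) β (Δ s) ρ (Y s) (Z s) i j)
      (nullMatrixDeriv (A s) β (Δ s) (Y s) (Z s) i j) s := by
  have h00 := (((hA.add_const (2 * β)).fun_add hΔ).div_const 4)
  have h11 := (((hA.sub_const (2 * β)).fun_add hΔ).div_const 4)
  have h01 := (hA.fun_sub hΔ).div_const 4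
  have h02 := (((((hA.fun_mul hY).fun_add (hY.const_mul β)).fun_add (hZ.const_mul β)).fun_add
    (hΔ.fun_mul hZ)).div_const 2).fun_neg
  have h12 := (((((hA.fun_mul hY).fun_sub (hY.const_mul β)).fun_add (hZ.const_mul β)).fun_sub
    (hΔ.fun_mul hZ)).div_const 2).fun_neg
  have h22 := ((((hA.fun_mul (hY.fun_pow 2)).fun_add ((hY.const_mul (2 * β)).fun_mul hZ)).fun_add
    (hΔ.fun_mul (hZ.fun_pow 2))).add_const ρ)
  fin_cases i <;> fin_cases j <;> simp only [nullMatrix, nullMatrixDeriv] <;>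
  first
  | exact h00.congr_deriv (by simp; ring)
  | exact h11.congr_deriv (by simp; ring)
  | exact h01.congr_deriv (by simp; ring)
  | exact h02.congr_deriv (by simp; ring)
  | exact h12.congr_deriv (by simp; ring)
  | exact h22.congr_deriv (by simp; ring)

theorem hasDerivAt_nullMatrixDeriv (hA : HasDerivAt A (-2 * A s) s)
    (hΔ : HasDerivAt Δ (2 * Δ s) s) (hY : HasDerivAt Y (Y s) s) (hZ : HasDerivAt Z (-Z s) s)
    (i j : Fin 3) :
    HasDerivAt (fun s => nullMatrixDeriv (A s) β (Δ s) (Y s) (Z s) i j)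
      (nullMatrixDeriv₂ (A s) β (Δ s) (Y s) (Z s) i j) s := by
  have h00 := (hΔ.fun_sub hA).div_const 2
  have h01 := ((hA.fun_add hΔ).div_const 2).fun_neg
  have h02 := ((((hA.fun_mul hY).fun_sub (hY.const_mul β)).fun_add (hZ.const_mul β)).fun_sub
    (hΔ.fun_mul hZ)).div_const 2
  have h12 := ((((hA.fun_mul hY).fun_add (hY.const_mul β)).fun_add (hZ.const_mul β)).fun_add
    (hΔ.fun_mul hZ)).div_const 2
  have h22 := hasDerivAt_const s (0 : ℝ)
  fin_cases i <;> fin_cases j <;> simp only [nullMatrixDeriv, nullMatrixDeriv₂] <;>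
  first
  | exact h00.congr_deriv (by simp; ring)
  | exact h01.congr_deriv (by simp; ring)
  | exact h02.congr_deriv (by simp; ring)
  | exact h12.congr_deriv (by simp; ring)
  | exact h22.congr_deriv (by simp)

theorem hasDerivAt_nullInv (hA : HasDerivAt A (-2 * A s) s)
    (hΔ : HasDerivAt Δ (2 * Δ s) s) (hY : HasDerivAt Y (Y s) s) (hZ : HasDerivAt Z (-Z s) s)
    (i j : Fin 3) :
    HasDerivAt (fun s => nullInv (A s) β (Δ s) ρ (Y s) (Z s) D i j)
      (nullInvDeriv (A s) (Δ s) ρ (Y s) (Z s) D i j) s := by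
  have ha := hY.fun_add hZ
  have hb := hY.fun_sub hZ
  have h00 := (((hA.sub_const (2 * β)).fun_add hΔ).div_const D).fun_add
    ((ha.fun_pow 2).div_const ρ)
  have h11 := (((hA.add_const (2 * β)).fun_add hΔ).div_const D).fun_add
    ((hb.fun_pow 2).div_const ρ)
  have h01 := ((hΔ.fun_sub hA).div_const D).fun_add ((ha.fun_mul hb).div_const ρ)
  have h02 := ha.div_const ρ
  have h12 := hb.div_const ρ
  have h22 := hasDerivAt_const s (1 / ρ)
  fin_cases i <;> fin_cases j <;> simp only [nullInv, nullInvDeriv] <;>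
  first
  | exact h00.congr_deriv (by simp; ring)
  | exact h11.congr_deriv (by simp; ring)
  | exact h01.congr_deriv (by simp; ring)
  | exact h02.congr_deriv (by simp; ring)
  | exact h12.congr_deriv (by simp)
  | exact h22

end Derivatives

/-- The tensor field `T` is the left-invariant extension of a null form. -/
def IsNull (T : TensorField) (α β δ ρ y z : ℝ) : Prop :=
  ∀ (p : E11) (u v : Fin 3 → ℝ),
    T p u v = nullForm α β δ ρ y z (boost (-p 2) u) (boost (-p 2) v)

theorem ric_of_isNull {g : Metric} {α β δ ρ y z D : ℝ} (hg : IsNull g.inner α β δ ρ y z)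
    (hρ : ρ ≠ 0) (hD : D ≠ 0) (h : α * δ - β ^ 2 = D) (p : E11) (u v : Fin 3 → ℝ) :
    Ric g p u v = nullForm (2 * β ^ 2 * α / (D * ρ)) (2 * α * δ * β / (D * ρ))
      (2 * β ^ 2 * δ / (D * ρ)) (-2 * α * δ / D) y z (boost (-p 2) u) (boost (-p 2) v) := by
  set A : ℝ → ℝ := fun s => α * (Real.exp s)⁻¹ ^ 2 with hA
  set Δ : ℝ → ℝ := fun s => δ * Real.exp s ^ 2 with hΔ
  set Y : ℝ → ℝ := fun s => y * Real.exp s with hY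
  set Z : ℝ → ℝ := fun s => z * (Real.exp s)⁻¹ with hZ
  have hexp : ∀ s, HasDerivAt Real.exp (Real.exp s) s := Real.hasDerivAt_exp
  have hexp' : ∀ s, HasDerivAt (fun s => (Real.exp s)⁻¹) (-(Real.exp s)⁻¹) s := fun s => by
    refine ((hexp s).fun_inv (Real.exp_pos s).ne').congr_deriv ?_
    field_simp
  have dA : ∀ s, HasDerivAt A (-2 * A s) s := fun s =>
    (((hexp' s).fun_pow 2).const_mul α).congr_deriv (by simp [hA]; ring)
  have dΔ : ∀ s, HasDerivAt Δ (2 * Δ s) s := fun s =>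
    (((hexp s).fun_pow 2).const_mul δ).congr_deriv (by simp [hΔ]; ring)
  have dY : ∀ s, HasDerivAt Y (Y s) s := fun s => (hexp s).const_mul y
  have dZ : ∀ s, HasDerivAt Z (-Z s) s := fun s =>
    ((hexp' s).const_mul z).congr_deriv (by simp [hZ])
  -- The exponentials cancel, so the planar determinant D is the same at every point.
  have hAΔ : ∀ s, A s * Δ s = α * δ := fun s => by
    have := (Real.exp_pos s).ne'
    simp only [hA, hΔ]
    field_simp
  have hAΔD : ∀ s, A s * Δ s - β ^ 2 = D := fun s => by rw [hAΔ, h]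
  have hcomp : ∀ x, components g x = nullMatrix (A (x 2)) β (Δ (x 2)) ρ (Y (x 2)) (Z (x 2)) := by
    intro x
    ext i j
    rw [← nullForm_single, ← nullForm_boost]
    exact hg x _ _
  have hric := fun i j x => Coord.ricci_eq_ricciOf (2 : Fin 3) hcomp
    (fun s => nullMatrix_inv hρ hD (hAΔD s) (Y s) (Z s))
    (fun s => hasDerivAt_nullMatrix β ρ (dA s) (dΔ s) (dY s) (dZ s))
    (fun s => hasDerivAt_nullMatrixDeriv β (dA s) (dΔ s) (dY s) (dZ s))
    (fun s => hasDerivAt_nullInv β ρ D (dA s) (dΔ s) (dY s) (dZ s)) i j x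
  rw [nullForm_boost, nullForm_eq_sum]
  unfold Ric
  refine Finset.sum_congr rfl fun i _ => Finset.sum_congr rfl fun j _ => ?_
  rw [hric i j p, ricciOf_null hρ hD (hAΔD _), nullForm_single]
  refine (mul_assoc _ _ _).trans ?_
  -- The Ricci coefficients at height s are the boosted ones of the identity, so Ricci is again the
  -- left-invariant extension of a null form.
  have hM : ∀ s, nullMatrix (2 * β ^ 2 * A s / (D * ρ)) (2 * A s * Δ s * β / (D * ρ))
      (2 * β ^ 2 * Δ s / (D * ρ)) (-2 * A s * Δ s / D) (Y s) (Z s)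
      = nullMatrix (2 * β ^ 2 * α / (D * ρ) * (Real.exp s)⁻¹ ^ 2) (2 * α * δ * β / (D * ρ))
        (2 * β ^ 2 * δ / (D * ρ) * Real.exp s ^ 2) (-2 * α * δ / D) (y * Real.exp s)
        (z * (Real.exp s)⁻¹) := by
    intro s
    rw [mul_assoc 2 (A s), mul_assoc (-2) (A s), hAΔ]
    congr 1 <;> (try simp only [hA, hΔ]) <;> ring
  exact congrArg (fun M : Matrix (Fin 3) (Fin 3) ℝ => M i j * (u i * v j)) (hM (p 2))

/-! ### Normal forms of metrics and of Milnor-diagonal tensors -/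

theorem eq_nullVec (y z : ℝ) (u : Fin 3 → ℝ) :
    u = ((u 0 + u 1) / 2 - y * u 2) • (![1, 1, 0] : Fin 3 → ℝ)
      + (((u 0 - u 1) / 2 - z * u 2) • (![1, -1, 0] : Fin 3 → ℝ)
        + u 2 • (![y + z, y - z, 1] : Fin 3 → ℝ)) := by
  funext i
  fin_cases i <;> simp <;> ring

/-- A bilinear form is a null form if it has the right values on a null frame. -/
theorem bilin_eq_nullForm {L : (Fin 3 → ℝ) →L[ℝ] (Fin 3 → ℝ) →L[ℝ] ℝ} {α β δ ρ y z : ℝ}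
    (huu : L ![1, 1, 0] ![1, 1, 0] = α) (huw : L ![1, 1, 0] ![1, -1, 0] = β)
    (hwu : L ![1, -1, 0] ![1, 1, 0] = β) (hww : L ![1, -1, 0] ![1, -1, 0] = δ)
    (hus : L ![1, 1, 0] ![y + z, y - z, 1] = 0) (hsu : L ![y + z, y - z, 1] ![1, 1, 0] = 0)
    (hws : L ![1, -1, 0] ![y + z, y - z, 1] = 0) (hsw : L ![y + z, y - z, 1] ![1, -1, 0] = 0)
    (hss : L ![y + z, y - z, 1] ![y + z, y - z, 1] = ρ) (u v : Fin 3 → ℝ) :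
    L u v = nullForm α β δ ρ y z u v := by
  conv_lhs => rw [eq_nullVec y z u, eq_nullVec y z v]
  simp only [map_add, map_smul, add_apply, smul_apply, smul_eq_mul, huu, huw, hwu, hww, hus, hsu,
    hws, hsw, hss, nullForm]
  ring

theorem isNull_of_bilin {T : TensorField} (hT : LeftInvariant T) {α β δ ρ y z : ℝ}
    {L : (Fin 3 → ℝ) →L[ℝ] (Fin 3 → ℝ) →L[ℝ] ℝ} (hL : L = T 1)
    (h : ∀ u v, L u v = nullForm α β δ ρ y z u v) : IsNull T α β δ ρ y z := by
  intro p u v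
  rw [hT.apply_eq, ← h, hL]
  rfl

theorem Metric.exists_isNull (g : Metric) (hg : LeftInvariant g.inner) :
    ∃ α β δ ρ y z : ℝ, 0 < α ∧ 0 < δ ∧ 0 < ρ ∧ 0 < α * δ - β ^ 2 ∧
      IsNull g.inner α β δ ρ y z := by
  obtain ⟨L, hL⟩ : ∃ L : (Fin 3 → ℝ) →L[ℝ] (Fin 3 → ℝ) →L[ℝ] ℝ, L = g.inner 1 := ⟨_, rfl⟩
  have hsymm : ∀ u v, L u v = L v u := fun u v => by rw [hL]; exact g.symm 1 u v
  have hpos : ∀ u, u ≠ 0 → 0 < L u u := fun u hu => by rw [hL]; exact g.pos 1 u hu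
  obtain ⟨α, hα⟩ : ∃ α, L ![1, 1, 0] ![1, 1, 0] = α := ⟨_, rfl⟩
  obtain ⟨β, hβ⟩ : ∃ β, L ![1, 1, 0] ![1, -1, 0] = β := ⟨_, rfl⟩
  obtain ⟨δ, hδ⟩ : ∃ δ, L ![1, -1, 0] ![1, -1, 0] = δ := ⟨_, rfl⟩
  obtain ⟨m, hm⟩ : ∃ m, L ![1, 1, 0] ![0, 0, 1] = m := ⟨_, rfl⟩
  obtain ⟨k, hk⟩ : ∃ k, L ![1, -1, 0] ![0, 0, 1] = k := ⟨_, rfl⟩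
  have hβ' : L ![1, -1, 0] ![1, 1, 0] = β := by rw [hsymm, hβ]
  have pα : 0 < α := hα ▸ hpos _ (fun h => by simpa using congrFun h 0)
  have pδ : 0 < δ := hδ ▸ hpos _ (fun h => by simpa using congrFun h 0)
  -- The vector βU - αW is orthogonal to U and has squared length α(αδ - β²).
  have pD : 0 < α * δ - β ^ 2 := by
    have h := hpos (β • ![1, 1, 0] - α • ![1, -1, 0]) (fun h => by
      have h0 := congrFun h 0
      have h1 := congrFun h 1
      simp at h0 h1
      linarith)
    simp only [map_sub, map_smul, sub_apply, smul_apply, smul_eq_mul, hα, hβ, hβ', hδ] at h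
    have e : 0 < α * (α * δ - β ^ 2) := by linarith
    exact pos_of_mul_pos_right e pα.le
  -- Cramer's rule for αy + βz = -m, βy + δz = -k, which makes S orthogonal to U and W.
  set y := (β * k - δ * m) / (α * δ - β ^ 2) with hy
  set z := (β * m - α * k) / (α * δ - β ^ 2) with hz
  have hy' : y * (α * δ - β ^ 2) = β * k - δ * m := div_mul_cancel₀ _ pD.ne'
  have hz' : z * (α * δ - β ^ 2) = β * m - α * k := div_mul_cancel₀ _ pD.ne'
  have hs : (![y + z, y - z, 1] : Fin 3 → ℝ)
      = y • ![1, 1, 0] + (z • ![1, -1, 0] + ![0, 0, 1]) := by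
    funext i
    fin_cases i
    · simp
    · simp; ring
    · simp
  have hus : L ![1, 1, 0] ![y + z, y - z, 1] = 0 := by
    rw [hs]
    simp only [map_add, map_smul, smul_eq_mul, hα, hβ, hm]
    apply mul_right_cancel₀ pD.ne'
    linear_combination α * hy' + β * hz'
  have hws : L ![1, -1, 0] ![y + z, y - z, 1] = 0 := by
    rw [hs]
    simp only [map_add, map_smul, smul_eq_mul, hβ', hδ, hk]
    apply mul_right_cancel₀ pD.ne'
    linear_combination β * hy' + δ * hz'
  refine ⟨α, β, δ, L ![y + z, y - z, 1] ![y + z, y - z, 1], y, z, pα, pδ, ?_, pD, ?_⟩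
  · exact hpos _ (fun h => by simpa using congrFun h 2)
  · exact isNull_of_bilin hg hL (bilin_eq_nullForm hα hβ hβ' hδ hus
      (by rw [hsymm, hus]) hws (by rw [hsymm, hws]) rfl)

theorem bracket_apply_zero (v w : LieAlg) (r : ℝ) (x : LieAlg) (h : ⁅v, w⁆ = r • x)
    {v' w' x' : Fin 3 → ℝ} (hv : v' = v) (hw : w' = w) (hx : x' = x) :
    v' 2 * w' 1 - w' 2 * v' 1 = r * x' 0 ∧ v' 2 * w' 0 - w' 2 * v' 0 = r * x' 1 ∧
      0 = r * x' 2 := by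
  subst hv hw hx
  have e := (bracket_eq v' w').symm.trans h
  exact ⟨congrFun e 0, congrFun e 1, congrFun e 2⟩

theorem IsDiagonal.apply_one {T : TensorField} {V : Module.Basis (Fin 3) ℝ LieAlg}
    {t : Fin 3 → ℝ} (h : IsDiagonal T V t) (i j : Fin 3) :
    T 1 (V i) (V j) = if i = j then t i else 0 := by
  rw [← h 1 i j, mulInvariantVectorField_eq, mulInvariantVectorField_eq]
  have e : ∀ v : Fin 3 → ℝ, boost ((1 : E11) 2) v = v := boost_zero
  exact (congrArg₂ (fun u v : Fin 3 → ℝ => (T 1 : (Fin 3 → ℝ) →L[ℝ] (Fin 3 → ℝ) →L[ℝ] ℝ) u v)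
    (e (V i)) (e (V j))).symm

/-- Brackets lie in the plane of U and W, so V₁ and V₂ do. Solving the relations gives 2aU = V₁ +
εV₂, 2bW = V₁ - εV₂ and V₃ = -2εS; expanding T by bilinearity yields the stated coefficients. -/
theorem IsDiagonal.exists_isNull {T : TensorField} (hT : LeftInvariant T)
    {V : Module.Basis (Fin 3) ℝ LieAlg} {t : Fin 3 → ℝ} (hV : IsMilnorBasis V)
    (h : IsDiagonal T V t) :
    ∃ a b y z : ℝ, a ≠ 0 ∧ b ≠ 0 ∧ IsNull T ((t 0 + t 1) / (4 * a ^ 2))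
      ((t 0 - t 1) / (4 * a * b)) ((t 0 + t 1) / (4 * b ^ 2)) (t 2 / 4) y z := by
  obtain ⟨L, hL⟩ : ∃ L : (Fin 3 → ℝ) →L[ℝ] (Fin 3 → ℝ) →L[ℝ] ℝ, L = T 1 := ⟨_, rfl⟩
  obtain ⟨v, hv⟩ : ∃ v : Fin 3 → (Fin 3 → ℝ), ∀ i, v i = V i := ⟨fun i => V i, fun i => rfl⟩
  have hd : ∀ i j, L (v i) (v j) = if i = j then t i else 0 := by
    intro i j
    rw [hL, hv, hv]
    exact h.apply_one i j
  obtain ⟨h1, h2, -⟩ := hV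
  obtain ⟨p1, p2, p3⟩ := bracket_apply_zero _ _ _ _ h1 (hv 1) (hv 2) (hv 0)
  obtain ⟨q1, q2, q3⟩ := bracket_apply_zero _ _ _ _ h2 (hv 2) (hv 0) (hv 1)
  have c0 : v 0 2 = 0 := by linarith
  have c1 : v 1 2 = 0 := by linarith
  have hne : ∀ r : ℝ, v 0 + r • v 1 ≠ 0 := by
    intro r hr
    have hr' : V 0 + r • V 1 = 0 := by
      have e0 := hv 0
      have e1 := hv 1
      rw [e0, e1] at hr
      exact hr
    have := congrArg (fun x => V.repr x 0) hr'
    simp at this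
  rw [c1] at p1 p2
  rw [c0] at q1 q2
  -- Eliminating V₂ from the two relations leaves (σ² - 4) V₁ = 0, where σ is the last entry of V₃.
  have hsq : (v 2 2 - 2) * (v 2 2 + 2) = 0 := by
    by_contra hc
    apply hne 0
    funext i
    fin_cases i
    · have : (v 2 2 - 2) * (v 2 2 + 2) * v 0 0 = 0 := by linear_combination v 2 2 * q2 + 2 * p1
      simpa [hc] using this
    · have : (v 2 2 - 2) * (v 2 2 + 2) * v 0 1 = 0 := by linear_combination v 2 2 * q1 + 2 * p2
      simpa [hc] using this
    · simpa using c0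
  -- Both signs occur, since (V₁, -V₂, -V₃) is again a Milnor basis.
  obtain ⟨ε, hε, hc2⟩ : ∃ ε : ℝ, ε * ε = 1 ∧ v 2 2 = -2 * ε := by
    rcases mul_eq_zero.1 hsq with h | h
    · exact ⟨-1, by norm_num, by linarith⟩
    · exact ⟨1, by norm_num, by linarith⟩
  have hε0 : ε ≠ 0 := fun h => by simp [h] at hε
  rw [hc2] at p1 p2
  set a := (v 0 0 + v 0 1) / 2 with ha
  set b := (v 0 0 - v 0 1) / 2 with hb
  set y := -ε * (v 2 0 + v 2 1) / 4 with hy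
  set z := -ε * (v 2 0 - v 2 1) / 4 with hz
  have e0 : v 0 = a • ![1, 1, 0] + b • ![1, -1, 0] := by
    funext i; fin_cases i <;> simp [ha, hb, c0] <;> ring
  have e1 : v 1 = (ε * a) • ![1, 1, 0] - (ε * b) • ![1, -1, 0] := by
    funext i
    fin_cases i
    · simp [ha, hb]; linear_combination (1 / 2 * ε) * p2 - v 1 0 * hε
    · simp [ha, hb]; linear_combination (1 / 2 * ε) * p1 - v 1 1 * hε
    · simp [c1]
  have e2 : v 2 = (-2 * ε) • ![y + z, y - z, 1] := by
    funext i
    fin_cases i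
    · simp [hy, hz]; linear_combination -v 2 0 * hε
    · simp [hy, hz]; linear_combination -v 2 1 * hε
    · simp [hc2]
  -- V₁ + εV₂ = 2aU cannot vanish by linear independence; likewise V₁ - εV₂ = 2bW for `b`.
  have ha0 : a ≠ 0 := by
    intro h0
    apply hne ε
    rw [e0, e1, h0]
    simp only [smul_sub, smul_smul, ← mul_assoc, hε]
    simp
  have hb0 : b ≠ 0 := by
    intro h0
    apply hne (-ε)
    rw [e0, e1, h0]
    simp only [smul_sub, smul_smul, neg_mul, ← mul_assoc, hε]
    simp
  have hd00 := hd 0 0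
  have hd01 := hd 0 1
  have hd10 := hd 1 0
  have hd11 := hd 1 1
  have hd02 := hd 0 2
  have hd12 := hd 1 2
  have hd20 := hd 2 0
  have hd21 := hd 2 1
  have hd22 := hd 2 2
  rw [e0] at hd00 hd01 hd10 hd02 hd20
  rw [e1] at hd01 hd10 hd11 hd12 hd21
  rw [e2] at hd02 hd12 hd20 hd21 hd22
  generalize hU : (![1, 1, 0] : Fin 3 → ℝ) = U at *
  generalize hW : (![1, -1, 0] : Fin 3 → ℝ) = W at *
  generalize hS : (![y + z, y - z, 1] : Fin 3 → ℝ) = S at *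
  simp only [map_add, map_sub, map_smul, add_apply, sub_apply, smul_apply, smul_eq_mul, if_true,
    Fin.reduceEq, if_false] at hd00 hd01 hd10 hd11 hd02 hd12 hd20 hd21 hd22
  have hε2 : ∀ x : ℝ, ε * x = 0 → x = 0 := fun x hx => (mul_eq_zero.1 hx).resolve_left hε0
  have k01 := hε2 (a * (a * L U U - b * L U W) + b * (a * L W U - b * L W W))
    (by linear_combination hd01)
  have k10 := hε2 (a * (a * L U U + b * L U W) - b * (a * L W U + b * L W W))
    (by linear_combination hd10)
  have k11 : a * (a * L U U - b * L U W) - b * (a * L W U - b * L W W) = t 1 := by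
    linear_combination hd11 -
      (a * (a * L U U - b * L U W) - b * (a * L W U - b * L W W)) * hε
  have k02 := hε2 (a * L U S + b * L W S) (by linear_combination (-1 / 2) * hd02)
  have k20 := hε2 (a * L S U + b * L S W) (by linear_combination (-1 / 2) * hd20)
  have k12 : a * L U S - b * L W S = 0 := by
    linear_combination (-1 / 2) * hd12 - (a * L U S - b * L W S) * hε
  have k21 : a * L S U - b * L S W = 0 := by
    linear_combination (-1 / 2) * hd21 - (a * L S U - b * L S W) * hε
  have k22 : 4 * L S S = t 2 := by linear_combination hd22 - 4 * L S S * hε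
  have hab := mul_ne_zero ha0 hb0
  refine ⟨a, b, y, z, ha0, hb0, isNull_of_bilin hT hL ?_⟩
  refine bilin_eq_nullForm ?_ ?_ ?_ ?_ ?_ ?_ ?_ ?_ ?_ <;> simp only [hU, hW, hS]
  · rw [eq_div_iff (by positivity)]
    linear_combination hd00 + k11 + k01 + k10
  · rw [eq_div_iff (by simpa [mul_assoc] using hab)]
    linear_combination hd00 - k11 - k01 + k10
  · rw [eq_div_iff (by simpa [mul_assoc] using hab)]
    linear_combination hd00 - k11 + k01 - k10
  · rw [eq_div_iff (by positivity)]
    linear_combination hd00 + k11 - k01 - k10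
  · apply mul_left_cancel₀ ha0
    linear_combination (k02 + k12) / 2
  · apply mul_left_cancel₀ ha0
    linear_combination (k20 + k21) / 2
  · apply mul_left_cancel₀ hb0
    linear_combination (k02 - k12) / 2
  · apply mul_left_cancel₀ hb0
    linear_combination (k20 - k21) / 2
  · linear_combination k22 / 4

/-! ### Reduction of the equation to scalar equations -/

theorem IsNull.leftInvariant {T : TensorField} {α β δ ρ y z : ℝ} (h : IsNull T α β δ ρ y z) :
    LeftInvariant T :=
  leftInvariant_of_apply_eq _ h

/-- Comparison of the values on U, W, e₂ at the identity. The numbers y and z are not compared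
directly, because a tensor degenerate on the plane does not determine them. -/
theorem IsNull.ext_iff {T : TensorField} {α β δ ρ y z α' β' δ' ρ' y' z' : ℝ}
    (h : IsNull T α β δ ρ y z) (h' : IsNull T α' β' δ' ρ' y' z') :
    α = α' ∧ β = β' ∧ δ = δ' ∧ α * y + β * z = α' * y' + β' * z' ∧
      β * y + δ * z = β' * y' + δ' * z' ∧
      α * y ^ 2 + 2 * β * y * z + δ * z ^ 2 + ρ
        = α' * y' ^ 2 + 2 * β' * y' * z' + δ' * z' ^ 2 + ρ' := by
  have e : ∀ u v, nullForm α β δ ρ y z u v = nullForm α' β' δ' ρ' y' z' u v := by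
    intro u v
    have b : ∀ u, boost (-(1 : E11) 2) u = u := fun u => by
      rw [show (1 : E11) 2 = 0 from rfl, neg_zero, boost_zero]
    have h1 := h 1 u v
    have h2 := h' 1 u v
    rw [b, b] at h1 h2
    exact h1.symm.trans h2
  have e1 := e ![1, 1, 0] ![1, 1, 0]
  have e2 := e ![1, 1, 0] ![1, -1, 0]
  have e3 := e ![1, -1, 0] ![1, -1, 0]
  have e4 := e ![1, 1, 0] ![0, 0, 1]
  have e5 := e ![1, -1, 0] ![0, 0, 1]
  have e6 := e ![0, 0, 1] ![0, 0, 1]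
  simp [nullForm] at e1 e2 e3 e4 e5 e6
  refine ⟨e1, ?_, ?_, ?_, ?_, ?_⟩
  · linarith
  · linarith
  · linarith
  · linarith
  · linarith

theorem nullForm_smul (r α β δ ρ y z : ℝ) (u v : Fin 3 → ℝ) :
    nullForm (r * α) (r * β) (r * δ) (r * ρ) y z u v = r * nullForm α β δ ρ y z u v := by
  simp only [nullForm]; ring

theorem isSolution_of_isNull {T : TensorField} {g : Metric} {α β δ ρ y z c : ℝ}
    (hg : IsNull g.inner α β δ ρ y z) (hρ : ρ ≠ 0) (hD : α * δ - β ^ 2 ≠ 0) (hc : 0 < c)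
    {A B C R : ℝ} (hT : IsNull T A B C R y z)
    (hA : 2 * β ^ 2 * α / ((α * δ - β ^ 2) * ρ) = c * A)
    (hB : 2 * α * δ * β / ((α * δ - β ^ 2) * ρ) = c * B)
    (hC : 2 * β ^ 2 * δ / ((α * δ - β ^ 2) * ρ) = c * C)
    (hR : -2 * α * δ / (α * δ - β ^ 2) = c * R) : IsSolution T g c := by
  refine ⟨hg.leftInvariant, hc, fun p u v => ?_⟩
  refine (ric_of_isNull hg hρ hD rfl p u v).trans ?_
  rw [hA, hB, hC, hR, nullForm_smul]
  exact congrArg (c * ·) (hT p u v).symm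

theorem IsSolution.exists_isNull {T : TensorField} {g : Metric} {c : ℝ} (h : IsSolution T g c) :
    ∃ α β δ ρ y z : ℝ, 0 < α ∧ 0 < δ ∧ 0 < ρ ∧ 0 < α * δ - β ^ 2 ∧
      IsNull g.inner α β δ ρ y z ∧
      IsNull T (2 * β ^ 2 * α / ((α * δ - β ^ 2) * ρ * c))
        (2 * α * δ * β / ((α * δ - β ^ 2) * ρ * c)) (2 * β ^ 2 * δ / ((α * δ - β ^ 2) * ρ * c))
        (-2 * α * δ / ((α * δ - β ^ 2) * c)) y z := by
  obtain ⟨hL, hc, hR⟩ := h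
  obtain ⟨α, β, δ, ρ, y, z, hα, hδ, hρ, hD, hg⟩ := g.exists_isNull hL
  refine ⟨α, β, δ, ρ, y, z, hα, hδ, hρ, hD, hg, fun p u v => ?_⟩
  apply mul_left_cancel₀ hc.ne'
  refine (hR p u v).symm.trans ?_
  refine (ric_of_isNull hg hρ.ne' hD.ne' rfl p u v).trans ?_
  rw [← nullForm_smul]
  have hc' := hc.ne'
  have hρ' := hρ.ne'
  have hD' := hD.ne'
  congr 1 <;> field_simp

theorem isNull_nullMetric {α β δ ρ : ℝ} (y z : ℝ) (hα : 0 < α) (hρ : 0 < ρ)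
    (hD : 0 < α * δ - β ^ 2) : IsNull (nullMetric α β δ ρ y z hα hρ hD).inner α β δ ρ y z :=
  nullMetric_inner hα hρ hD

theorem Homothetic.of_isNull {g h : Metric} {α β δ ρ y z r : ℝ} (hr : 0 < r)
    (hg : IsNull g.inner α β δ ρ y z)
    (hh : IsNull h.inner (r * α) (r * β) (r * δ) (r * ρ) y z) : Homothetic g h := by
  refine ⟨r, hr, fun p u v => ?_⟩
  refine (hh p u v).trans ?_
  rw [nullForm_smul]
  exact congrArg (r * ·) (hg p u v).symm

/-! ### Milnor bases from null frames, and necessity of the two cases -/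

/-- A Milnor basis in a given null frame. -/
theorem exists_milnorBasis {T : TensorField} {a b y z : ℝ} (ha : a ≠ 0) (hb : b ≠ 0)
    {t : Fin 3 → ℝ} (hT : IsNull T ((t 0 + t 1) / (4 * a ^ 2)) ((t 0 - t 1) / (4 * a * b))
      ((t 0 + t 1) / (4 * b ^ 2)) (t 2 / 4) y z) :
    ∃ V : Module.Basis (Fin 3) ℝ LieAlg, IsMilnorBasis V ∧ IsDiagonal T V t := by
  -- The rows are aU + bW, aU - bW and -2S, the normal form with ε = 1.
  obtain ⟨M, hM⟩ : ∃ M : Matrix (Fin 3) (Fin 3) ℝ,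
    M = !![a + b, a - b, 0; a - b, a + b, 0; -2 * (y + z), -2 * (y - z), -2] := ⟨_, rfl⟩
  have hdet : M.det ≠ 0 := by
    have : M.det = -8 * a * b := by
      rw [hM, Matrix.det_fin_three]
      simp
      ring
    rw [this]
    simp [ha, hb]
  have hli : LinearIndependent ℝ (fun i => M i) := Matrix.linearIndependent_rows_of_det_ne_zero hdet
  obtain ⟨B, hB⟩ : ∃ B : Module.Basis (Fin 3) ℝ (Fin 3 → ℝ), ∀ i, B i = M i :=
    ⟨basisOfLinearIndependentOfCardEqFinrank hli (by simp), fun i => by simp⟩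
  obtain ⟨V, hV⟩ : ∃ V : Module.Basis (Fin 3) ℝ LieAlg, ∀ i, V i = M i := ⟨B, hB⟩
  have br : ∀ (i j k : Fin 3) (r : ℝ), M i 2 * M j 1 - M j 2 * M i 1 = r * M k 0 →
      M i 2 * M j 0 - M j 2 * M i 0 = r * M k 1 → 0 = r * M k 2 → ⁅V i, V j⁆ = r • V k := by
    intro i j k r h0 h1 h2
    refine (bracket_eq _ _).trans ?_
    have : (![M i 2 * M j 1 - M j 2 * M i 1, M i 2 * M j 0 - M j 2 * M i 0, 0] : Fin 3 → ℝ)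
        = r • M k := by
      funext l
      fin_cases l
      · simpa using h0
      · simpa using h1
      · simpa using h2
    rw [hV, hV, hV]
    exact this
  refine ⟨V, ⟨br 1 2 0 2 ?_ ?_ ?_, br 2 0 1 (-2) ?_ ?_ ?_, br 0 1 2 0 ?_ ?_ ?_⟩, ?_⟩
  any_goals (simp [hM]; try ring)
  intro p i j
  have hv : ∀ i, (mulInvariantVectorField (V i) p : Tan p) = boost (p 2) (M i) := by
    intro i
    rw [mulInvariantVectorField_eq, hV]
  rw [hv, hv]
  refine (hT p _ _).trans ?_
  have e : ∀ u, boost (-p 2) (boost (p 2) u) = u := fun u => by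
    rw [boost_boost, neg_add_cancel, boost_zero]
  refine (congrArg₂ _ (e (M i)) (e (M j))).trans ?_
  rw [hM]
  fin_cases i <;> fin_cases j <;> simp [nullForm] <;> field_simp <;> ring

/-- A tensor field with a solution is diagonal in a Milnor basis with the signature of one of the
two solvable cases. -/
theorem IsSolution.exists_milnorBasis {T : TensorField} {g : Metric} {c : ℝ}
    (h : IsSolution T g c) :
    ∃ (V : Module.Basis (Fin 3) ℝ LieAlg) (t : Fin 3 → ℝ), IsMilnorBasis V ∧ IsDiagonal T V t ∧
      ((t 0 = 0 ∧ t 1 = 0 ∧ t 2 < 0) ∨ (0 < t 0 + t 1 ∧ t 2 < 0 ∧ t 0 * t 1 < 0)) := by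
  have hc := h.2.1
  obtain ⟨α, β, δ, ρ, y, z, hα, hδ, hρ, hD, -, hT⟩ := h.exists_isNull
  -- With a² = δ and b² = α, a²T(U,U) = b²T(W,W), as diagonality requires.
  obtain ⟨a, ha, ha2⟩ : ∃ a, 0 < a ∧ a ^ 2 = δ := ⟨√δ, Real.sqrt_pos.2 hδ, Real.sq_sqrt hδ.le⟩
  obtain ⟨b, hb, hb2⟩ : ∃ b, 0 < b ∧ b ^ 2 = α := ⟨√α, Real.sqrt_pos.2 hα, Real.sq_sqrt hα.le⟩
  obtain ⟨K, hK, hKe⟩ : ∃ K, 0 < K ∧ (α * δ - β ^ 2) * ρ * c = K := ⟨_, by positivity, rfl⟩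
  obtain ⟨J, hJ, hJe⟩ : ∃ J, 0 < J ∧ (α * δ - β ^ 2) * c = J := ⟨_, by positivity, rfl⟩
  rw [hKe, hJe] at hT
  -- Solution of t₁ + t₂ = 4a²T(U,U), t₁ - t₂ = 4ab T(U,W), t₃ = 4T(S,S).
  set t : Fin 3 → ℝ := ![4 * α * δ * β * (β + a * b) / K, 4 * α * δ * β * (β - a * b) / K,
    -8 * α * δ / J] with ht
  have t0 : t 0 = 4 * α * δ * β * (β + a * b) / K := rfl
  have t1 : t 1 = 4 * α * δ * β * (β - a * b) / K := rfl
  have t2 : t 2 = -8 * α * δ / J := rfl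
  have hsum : t 0 + t 1 = 8 * α * δ * β ^ 2 / K := by rw [t0, t1]; ring
  have hdiff : t 0 - t 1 = 8 * α * δ * β * (a * b) / K := by rw [t0, t1]; ring
  have hprod : t 0 * t 1 = -(16 * (α * δ * β) ^ 2 * (α * δ - β ^ 2)) / K ^ 2 := by
    rw [t0, t1]
    field_simp
    rw [← ha2, ← hb2]
    ring
  have ht2 : t 2 < 0 := by
    rw [t2]
    exact div_neg_of_neg_of_pos (by nlinarith [mul_pos hα hδ]) hJ
  have hT' : IsNull T ((t 0 + t 1) / (4 * a ^ 2)) ((t 0 - t 1) / (4 * a * b))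
      ((t 0 + t 1) / (4 * b ^ 2)) (t 2 / 4) y z := by
    rw [hsum, hdiff, t2, ha2, hb2]
    convert hT using 1 <;> field_simp <;> ring
  obtain ⟨V, hV, hVd⟩ := E11.exists_milnorBasis ha.ne' hb.ne' hT'
  refine ⟨V, t, hV, hVd, ?_⟩
  rcases eq_or_ne β 0 with hβ | hβ
  · exact Or.inl ⟨by rw [t0, hβ]; simp, by rw [t1, hβ]; simp, ht2⟩
  · refine Or.inr ⟨by rw [hsum]; positivity, ht2, ?_⟩
    rw [hprod]
    exact div_neg_of_neg_of_pos (neg_neg_of_pos (by positivity)) (by positivity)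

/-! ### The degenerate case -/

/-- The metrics solving the equation in the degenerate case. -/
theorem isSolution_degenerate {T : TensorField} {R y z ρ : ℝ} (hR : R < 0)
    (hT : IsNull T 0 0 0 R y z) (hρ : 0 < ρ) :
    IsSolution T (nullMetric 1 0 1 ρ y z one_pos hρ (by norm_num)) (-2 / R) := by
  have hc : 0 < -2 / R := div_pos_of_neg_of_neg (by norm_num) hR
  refine isSolution_of_isNull (isNull_nullMetric y z one_pos hρ (by norm_num)) hρ.ne'
    (by norm_num) hc hT ?_ ?_ ?_ ?_
  · simp
  · simp
  · simp
  · rw [div_mul_cancel₀ _ hR.ne]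
    norm_num

/-- Vanishing of T on the plane forces β = 0; then αδ = D and the remaining equation is R = -2/c,
with ρ absent. -/
theorem IsSolution.const_eq_of_degenerate {T : TensorField} {R y z : ℝ}
    (hT : IsNull T 0 0 0 R y z) {g : Metric} {c : ℝ} (h : IsSolution T g c) : c = -2 / R := by
  have hc := h.2.1
  obtain ⟨α, β, δ, ρ, y', z', hα, hδ, hρ, hD, -, hT'⟩ := h.exists_isNull
  obtain ⟨h1, h2, h3, -, -, h6⟩ := hT.ext_iff hT'
  have hβ : β = 0 := by
    by_contra hβ
    have : 0 < 2 * β ^ 2 * α / ((α * δ - β ^ 2) * ρ * c) := by positivity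
    linarith
  subst hβ
  rw [← h1, ← h2, ← h3] at h6
  have e : R = -2 * α * δ / ((α * δ - 0 ^ 2) * c) := by linarith
  rw [e]
  field_simp
  simp

/-- The two metrics agree on the plane, so the factor is 1 and ρ is an invariant. -/
theorem not_homothetic_degenerate {y z ρ ρ' : ℝ} (hρ : 0 < ρ) (hρ' : 0 < ρ') (hne : ρ ≠ ρ') :
    ¬ Homothetic (nullMetric 1 0 1 ρ y z one_pos hρ (by norm_num))
      (nullMetric 1 0 1 ρ' y z one_pos hρ' (by norm_num)) := by
  rintro ⟨r, -, h⟩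
  have h1 := isNull_nullMetric y z (one_pos (α := ℝ)) hρ (β := 0) (δ := 1) (by norm_num)
  have h2 := isNull_nullMetric y z (one_pos (α := ℝ)) hρ' (β := 0) (δ := 1) (by norm_num)
  have h3 : IsNull (nullMetric 1 0 1 ρ' y z one_pos hρ' (by norm_num)).inner
      (r * 1) (r * 0) (r * 1) (r * ρ) y z := by
    intro p u v
    rw [nullForm_smul, ← h1 p u v]
    exact h p u v
  obtain ⟨e1, -, -, -, -, e6⟩ := h2.ext_iff h3
  have hr : r = 1 := by linarith
  subst hr
  apply hne
  linarith

/-! ### The non-degenerate case -/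

/-- The solution in the non-degenerate case. -/
theorem exists_isSolution_nondegenerate {T : TensorField} {a b y z : ℝ} (ha : a ≠ 0) (hb : b ≠ 0)
    {t : Fin 3 → ℝ} (hT : IsNull T ((t 0 + t 1) / (4 * a ^ 2)) ((t 0 - t 1) / (4 * a * b))
      ((t 0 + t 1) / (4 * b ^ 2)) (t 2 / 4) y z) (hsum : 0 < t 0 + t 1) (ht2 : t 2 < 0)
    (hprod : t 0 * t 1 < 0) : ∃ (g : Metric) (c : ℝ), IsSolution T g c := by
  obtain ⟨X, hX⟩ : ∃ X, t 0 + t 1 = X := ⟨_, rfl⟩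
  obtain ⟨Y, hY⟩ : ∃ Y, t 0 - t 1 = Y := ⟨_, rfl⟩
  obtain ⟨τ, hτ⟩ : ∃ τ, -t 2 = τ := ⟨_, rfl⟩
  -- Y² - X² = -4 t₁t₂.
  have hXY : 0 < Y ^ 2 - X ^ 2 := by rw [← hX, ← hY]; linarith
  have hτ' : t 2 = -τ := by linarith
  have pτ : 0 < τ := by linarith
  rw [hX] at hsum
  rw [hX, hY, hτ'] at hT
  have hY0 : Y ≠ 0 := by
    rintro rfl
    nlinarith [sq_nonneg X]
  have pY2 : 0 < Y ^ 2 := by positivity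
  -- Up to scale take α = 1/a², δ = 1/b². Then T(U,W)/T(U,U) = δ/β gives β = X/(Yab), the S-equation
  -- gives c = 8Y²/(τ(Y² - X²)), and the U,U-equation gives ρ = τX/Y².
  have pa : 0 < 1 / a ^ 2 := by positivity
  have pρ : 0 < τ * X / Y ^ 2 := by positivity
  have hDe : 1 / a ^ 2 * (1 / b ^ 2) - (X / (Y * a * b)) ^ 2
      = (Y ^ 2 - X ^ 2) / (Y ^ 2 * a ^ 2 * b ^ 2) := by
    field_simp
  have hD : 0 < 1 / a ^ 2 * (1 / b ^ 2) - (X / (Y * a * b)) ^ 2 := by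
    rw [hDe]; positivity
  have hc : 0 < 8 * Y ^ 2 / (τ * (Y ^ 2 - X ^ 2)) := by positivity
  refine ⟨_, _, isSolution_of_isNull (isNull_nullMetric y z pa pρ hD) pρ.ne' hD.ne' hc hT
    ?_ ?_ ?_ ?_⟩
  all_goals
    rw [hDe]
    have h1 := hXY.ne'
    have h2 := hsum.ne'
    have h3 := pτ.ne'
    field_simp
    try norm_num

/-- Two solutions for the same non-degenerate tensor have the same constant and are homothetic. -/
theorem IsSolution.unique {T : TensorField} {A B C R y z : ℝ} (hT : IsNull T A B C R y z)
    (hA : A ≠ 0) {g g' : Metric} {c c' : ℝ} (h : IsSolution T g c) (h' : IsSolution T g' c') :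
    c' = c ∧ Homothetic g g' := by
  have hc := h.2.1
  have hc' := h'.2.1
  obtain ⟨α, β, δ, ρ, y₁, z₁, hα, hδ, hρ, hD, hg, h₁⟩ := h.exists_isNull
  obtain ⟨α', β', δ', ρ', y₂, z₂, hα', hδ', hρ', hD', hg', h₂⟩ := h'.exists_isNull
  have hβ : β ≠ 0 := by
    rintro rfl
    exact hA ((hT.ext_iff h₁).1.trans (by simp))
  have hβ' : β' ≠ 0 := by
    rintro rfl
    exact hA ((hT.ext_iff h₂).1.trans (by simp))
  obtain ⟨e1, e2, e3, e4, e5, e6⟩ := h₁.ext_iff h₂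
  obtain ⟨D, hDe⟩ : ∃ D, α * δ - β ^ 2 = D := ⟨_, rfl⟩
  obtain ⟨D', hDe'⟩ : ∃ D', α' * δ' - β' ^ 2 = D' := ⟨_, rfl⟩
  rw [hDe] at hD
  rw [hDe'] at hD'
  rw [hDe, hDe'] at e1 e2 e3 e4 e5 e6
  obtain ⟨κ, hκ⟩ : ∃ κ, 2 / (D * ρ * c) = κ := ⟨_, rfl⟩
  obtain ⟨κ', hκ'⟩ : ∃ κ', 2 / (D' * ρ' * c') = κ' := ⟨_, rfl⟩
  have pκ : 0 < κ := hκ ▸ by positivity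
  have pκ' : 0 < κ' := hκ' ▸ by positivity
  have f1 : 2 * β ^ 2 * α / (D * ρ * c) = κ * (β ^ 2 * α) := by rw [← hκ]; ring
  have f2 : 2 * α * δ * β / (D * ρ * c) = κ * (α * δ * β) := by rw [← hκ]; ring
  have f3 : 2 * β ^ 2 * δ / (D * ρ * c) = κ * (β ^ 2 * δ) := by rw [← hκ]; ring
  have f1' : 2 * β' ^ 2 * α' / (D' * ρ' * c') = κ' * (β' ^ 2 * α') := by rw [← hκ']; ring
  have f2' : 2 * α' * δ' * β' / (D' * ρ' * c') = κ' * (α' * δ' * β') := by rw [← hκ']; ring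
  have f3' : 2 * β' ^ 2 * δ' / (D' * ρ' * c') = κ' * (β' ^ 2 * δ') := by rw [← hκ']; ring
  rw [f1, f2] at e4
  rw [f2, f3] at e5
  rw [f1, f2, f3] at e6
  -- Both sides now carry the same planar coefficients of T and differ only in y and z.
  rw [← e1, ← e2, f1, f2] at e4
  rw [← e2, ← e3, f2, f3] at e5
  rw [← e1, ← e2, ← e3, f1, f2, f3] at e6
  rw [f1, f1'] at e1
  rw [f2, f2'] at e2
  rw [f3, f3'] at e3
  -- The linear system for (y, z) is invertible because β ≠ 0 and D ≠ 0.
  have hy : y₁ = y₂ := by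
    have hN : κ * β * α * D ≠ 0 := by positivity
    apply mul_left_cancel₀ hN
    rw [← hDe]
    linear_combination α * e5 - β * e4
  have hz : z₁ = z₂ := by
    have hN : κ * β * δ * D ≠ 0 := by positivity
    apply mul_left_cancel₀ hN
    rw [← hDe]
    linear_combination δ * e4 - β * e5
  subst hy hz
  have e7 : -2 * α * δ / (D * c) = -2 * α' * δ' / (D' * c') := by linarith
  -- T(U,U)/T(U,W) = β/δ does not involve ρ or c; likewise T(W,W)/T(U,W) = β/α below.
  have g1 : β * δ' = β' * δ := by
    have hN : κ * κ' * α * α' * β * β' ≠ 0 := by positivity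
    apply mul_left_cancel₀ hN
    linear_combination κ' * α' * δ' * β' * e1 - κ' * β' ^ 2 * α' * e2
  have g2 : β * α' = β' * α := by
    have hN : κ * κ' * δ * δ' * β * β' ≠ 0 := by positivity
    apply mul_left_cancel₀ hN
    linear_combination κ' * α' * δ' * β' * e3 - κ' * β' ^ 2 * δ' * e2
  obtain ⟨r, hr⟩ : ∃ r, β' / β = r := ⟨_, rfl⟩
  have hβr : β' = r * β := by rw [← hr]; field_simp
  have hαr : α' = r * α := by
    apply mul_left_cancel₀ hβ
    rw [g2, hβr]; ring
  have hδr : δ' = r * δ := by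
    apply mul_left_cancel₀ hβ
    rw [g1, hβr]; ring
  have pr : 0 < r := by
    rw [hαr] at hα'
    exact pos_of_mul_pos_left hα' hα.le
  have hDr : D' = r ^ 2 * D := by rw [← hDe', ← hDe, hβr, hαr, hδr]; ring
  -- αδ/D is invariant under scaling, so the S-equation determines c.
  have hcc : c' = c := by
    rw [hDr, hαr, hδr] at e7
    field_simp at e7
    linarith
  subst hcc
  have hρr : ρ' = r * ρ := by
    rw [hαr, hβr, ← hκ, ← hκ', hDr] at e1
    field_simp at e1
    linarith
  refine ⟨rfl, Homothetic.of_isNull pr hg ?_⟩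
  rw [← hαr, ← hβr, ← hδr, ← hρr]
  exact hg'

end E11

end

/-! ### Assembly of the theorem -/

namespace E11

theorem IsDiagonal.exists_isNull_degenerate {T : TensorField} (hT : LeftInvariant T)
    {V : Module.Basis (Fin 3) ℝ LieAlg} {t : Fin 3 → ℝ} (hV : IsMilnorBasis V)
    (h : IsDiagonal T V t) (h0 : t 0 = 0) (h1 : t 1 = 0) (h2 : t 2 < 0) :
    ∃ R y z : ℝ, R < 0 ∧ IsNull T 0 0 0 R y z := by
  obtain ⟨a, b, y, z, -, -, hN⟩ := h.exists_isNull hT hV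
  refine ⟨t 2 / 4, y, z, by linarith, ?_⟩
  simpa [h0, h1] using hN

end E11

theorem mainTheorem5 (T : E11.TensorField) (hT : E11.LeftInvariant T) :
    -- solvability
    ((∃ (g : E11.Metric) (c : ℝ), E11.IsSolution T g c) ↔
      ∃ (V : Module.Basis (Fin 3) ℝ E11.LieAlg) (t : Fin 3 → ℝ),
        E11.IsMilnorBasis V ∧ E11.IsDiagonal T V t ∧
          ((t 0 = 0 ∧ t 1 = 0 ∧ t 2 < 0) ∨
            (0 < t 0 + t 1 ∧ t 2 < 0 ∧ t 0 * t 1 < 0))) ∧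
    -- the solutions in each of the two cases
    ∀ (V : Module.Basis (Fin 3) ℝ E11.LieAlg) (t : Fin 3 → ℝ),
      E11.IsMilnorBasis V → E11.IsDiagonal T V t →
        ((t 0 = 0 ∧ t 1 = 0 ∧ t 2 < 0) →
          ∃ c : ℝ,
            (∃ γ : ℕ → E11.Metric, (∀ n, E11.IsSolution T (γ n) c) ∧
              ∀ m n, m ≠ n → ¬ E11.Homothetic (γ m) (γ n)) ∧
            ∀ (g : E11.Metric) (c' : ℝ), E11.IsSolution T g c' → c' = c) ∧
        ((0 < t 0 + t 1 ∧ t 2 < 0 ∧ t 0 * t 1 < 0) →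
          ∃ (g : E11.Metric) (c : ℝ), E11.IsSolution T g c ∧
            ∀ (g' : E11.Metric) (c' : ℝ), E11.IsSolution T g' c' →
              c' = c ∧ E11.Homothetic g g') := by
  refine ⟨⟨?_, ?_⟩, fun V t hV ht => ⟨?_, ?_⟩⟩
  · rintro ⟨g, c, h⟩
    exact h.exists_milnorBasis
  · rintro ⟨V, t, hV, ht, ⟨h0, h1, h2⟩ | ⟨h0, h1, h2⟩⟩
    · obtain ⟨R, y, z, hR, hN⟩ := ht.exists_isNull_degenerate hT hV h0 h1 h2
      exact ⟨_, _, E11.isSolution_degenerate hR hN one_pos⟩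
    · obtain ⟨a, b, y, z, ha, hb, hN⟩ := ht.exists_isNull hT hV
      exact E11.exists_isSolution_nondegenerate ha hb hN h0 h1 h2
  · rintro ⟨h0, h1, h2⟩
    obtain ⟨R, y, z, hR, hN⟩ := ht.exists_isNull_degenerate hT hV h0 h1 h2
    -- The family takes ρ = n + 1; the shift keeps ρ positive at n = 0.
    refine ⟨-2 / R, ⟨_, fun n => E11.isSolution_degenerate hR hN (Nat.cast_add_one_pos n),
      fun m n hmn => E11.not_homothetic_degenerate _ _ fun h => hmn ?_⟩,
      fun g c' h => h.const_eq_of_degenerate hN⟩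
    exact_mod_cast add_right_cancel h
  · rintro ⟨h0, h1, h2⟩
    obtain ⟨a, b, y, z, ha, hb, hN⟩ := ht.exists_isNull hT hV
    obtain ⟨g, c, h⟩ := E11.exists_isSolution_nondegenerate ha hb hN h0 h1 h2
    -- The positivity goal is T(U,U) = (t₁ + t₂)/4a² ≠ 0.
    exact ⟨g, c, h, fun g' c' h' => h.unique hN (by positivity) h'⟩
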